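/- Let $k$ be an algebraically closed field, $V$ a finite-dimensional $k$-vector space, and $G$ a finite group acting linearly on $V$; assume that $\mathrm{char}\,k$ is $0$ or greater than both $\dim V$ and $|G|$. Let $k[V]=\mathrm{Sym}(V^*)$ be the algebra of polynomial functions, on which $G$ acts by $a^g(v)=a(g^{-1}v)$. For $g\in G$ let $k[V]g=\{bg\}$ be the $k[V]$-subbimodule of the crossed product $k[G]\ltimes k[V]$, in which $g\,c=c^g g$, so that $a\cdot(bg)\cdot c=(a\,b\,c^g)g$. Let $V^g\subseteq V$ be the subspace of $g$-invariant vectors, let $d_g=\operatorname{codim}V^g$, and let $(V^g)^\vee\subseteq V$ denote the span of the eigenvectors of $g$ with eigenvalue different from $1$ (so $V=V^g\oplus (V^g)^\vee$). Regard $k[V^g]$ as a $k[V]$-bimodule by restriction of functions. Let $H^i(A,M)$ denote the Hochschild cohomology of a $k$-algebra $A$ with coefficients in an $A$-bimodule $M$, that is, the cohomology of the complex of cochains $C^i(A,M)=\mathrm{Hom}_k(A^{\otimes i},M)$. Then there are isomorphisms of $k$-vector spaces, for all $i\ge 0$, 1. $\Phi_i:\ H^i(k[V],k[V]g)\;\cong\;\Lambda^{i-d_g}V^g\otimes\Lambda^{d_g}(V^g)^\vee\otimes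 k[V^g]$, where the right-hand side is $0$ if $i<d_g$; 2. $\Psi_i:\ H^i(k[V],k[V^g])\;\cong\;\Lambda^iV\otimes k[V^g]$, where $\Psi_i$ is the canonical map given by antisymmetrization on linear functions: for every Hochschild cocycle $c$ and all $y_1,\dots,y_i\in V^*$, the contraction of $\Psi_i([c])$ with $y_1\wedge\dots\wedge y_i$ (normalized by $\langle v_1\wedge\dots\wedge v_i,\,y_1\wedge\dots\wedge y_i\rangle=\det(y_j(v_l))$) equals $\sum_{\sigma\in S_i}\operatorname{sgn}(\sigma)\,c(y_{\sigma(1)},\dots,y_{\sigma(i)})\in k[V^g]$; 3. such that, under $\Phi_i$ and $\Psi_i$, the map $H^i(k[V],k[V]g)\to H^i(k[V],k[V^g])$ induced by the bimodule morphism $k[V]g\to k[V^g]g\cong k[V^g]$, $bg\mapsto b|_{V^g}$, is the natural inclusion $\Lambda^{i-d_g}V^g\otimes\Lambda^{d_g}(V^g)^\vee\otimes k[V^g]\to\Lambda^iV\otimes k[V^g]$, $\xi\otimes\omega\otimes f\mapsto(\xi\wedge\omega)\otimes f$. -/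

import Mathlib

open scoped TensorProduct MulOpposite

/-! ### Hochschild cohomology of an algebra with coefficients in a bimodule -/

section Hochschild

/-- Updating an argument before multiplying the neighbours `j` and `j + 1`. -/
theorem contractNth_update_lt {A : Type*} [Mul A] {n : ℕ} (j : Fin n) (a : Fin (n + 1) → A)
    (m : Fin (n + 1)) (x : A) (h : (m : ℕ) < j) :
    Fin.contractNth j.castSucc (· * ·) (Function.update a m x) =
      Function.update (Fin.contractNth j.castSucc (· * ·) a) ⟨m, h.trans j.2⟩ x := by
  funext i
  simp only [Fin.contractNth, Function.update_apply, Fin.ext_iff, Fin.val_castSucc, Fin.val_succ]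
  grind

theorem contractNth_update_eq {A : Type*} [Mul A] {n : ℕ} (j : Fin n) (a : Fin (n + 1) → A)
    (x : A) :
    Fin.contractNth j.castSucc (· * ·) (Function.update a j.castSucc x) =
      Function.update (Fin.contractNth j.castSucc (· * ·) a) j (x * a j.succ) := by
  funext i
  simp only [Fin.contractNth, Function.update_apply, Fin.ext_iff, Fin.val_castSucc, Fin.val_succ]
  grind

theorem contractNth_update_succ {A : Type*} [Mul A] {n : ℕ} (j : Fin n) (a : Fin (n + 1) → A)
    (x : A) :
    Fin.contractNth j.castSucc (· * ·) (Function.update a j.succ x) =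
      Function.update (Fin.contractNth j.castSucc (· * ·) a) j (a j.castSucc * x) := by
  funext i
  simp only [Fin.contractNth, Function.update_apply, Fin.ext_iff, Fin.val_castSucc, Fin.val_succ]
  grind

theorem contractNth_update_gt {A : Type*} [Mul A] {n : ℕ} (j : Fin n) (a : Fin (n + 1) → A)
    (m : Fin n) (x : A) (h : (j : ℕ) < m) :
    Fin.contractNth j.castSucc (· * ·) (Function.update a m.succ x) =
      Function.update (Fin.contractNth j.castSucc (· * ·) a) m x := by
  funext i
  simp only [Fin.contractNth, Function.update_apply, Fin.ext_iff, Fin.val_castSucc, Fin.val_succ]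
  grind

/-- Every way of changing one argument falls under one of the four cases above. -/
theorem contractNth_cases {n : ℕ} (j : Fin n) (m : Fin (n + 1)) :
    (m : ℕ) < j ∨ m = j.castSucc ∨ m = j.succ ∨ ∃ m' : Fin n, m = m'.succ ∧ (j : ℕ) < m' := by
  rcases Nat.lt_trichotomy (m : ℕ) j with h | h | h
  · exact Or.inl h
  · exact Or.inr (Or.inl (Fin.ext h))
  · rcases Nat.lt_or_ge ((j : ℕ) + 1) m with h' | h'
    · refine Or.inr (Or.inr (Or.inr ⟨⟨(m : ℕ) - 1, by omega⟩, Fin.ext ?_, ?_⟩))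
      · simp only [Fin.val_succ]; omega
      · simp only; omega
    · exact Or.inr (Or.inr (Or.inl (Fin.ext (by simp only [Fin.val_succ]; omega))))

variable (k : Type*) [CommRing k] (A : Type*) [Ring A] [Algebra k A]
variable (M : Type*) [AddCommGroup M] [Module k M] [Module A M] [Module Aᵐᵒᵖ M]

/-- Hochschild cochains: `k`-multilinear maps `A × ⋯ × A → M` of `n` arguments, that is,
`Hom_k(A^{⊗ n}, M)`. -/
abbrev HochschildCochain (n : ℕ) : Type _ := MultilinearMap k (fun _ : Fin n => A) M

variable {k A M}

/-- The term `c(a₀, …, a_j a_{j+1}, …, a_n)` of the Hochschild differential. -/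
def hochschildInner {n : ℕ} (j : Fin n) (c : HochschildCochain k A M n) :
    HochschildCochain k A M (n + 1) :=
  MultilinearMap.mk' (fun a => c (Fin.contractNth j.castSucc (· * ·) a))
    (fun a m x y => by
      rcases contractNth_cases j m with h | rfl | rfl | ⟨m, rfl, h⟩
      · simp only [contractNth_update_lt j a m _ h, c.map_update_add]
      · simp only [contractNth_update_eq, add_mul, c.map_update_add]
      · simp only [contractNth_update_succ, mul_add, c.map_update_add]
      · simp only [contractNth_update_gt j a m _ h, c.map_update_add])
    (fun a m t x => by
      rcases contractNth_cases j m with h | rfl | rfl | ⟨m, rfl, h⟩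
      · simp only [contractNth_update_lt j a m _ h, c.map_update_smul]
      · simp only [contractNth_update_eq, smul_mul_assoc, c.map_update_smul]
      · simp only [contractNth_update_succ, mul_smul_comm, c.map_update_smul]
      · simp only [contractNth_update_gt j a m _ h, c.map_update_smul])

variable [IsScalarTower k A M] [IsScalarTower k Aᵐᵒᵖ M]

/-- The first term `a₀ · c(a₁, …, a_n)` of the Hochschild differential. -/
def hochschildFirst {n : ℕ} (c : HochschildCochain k A M n) : HochschildCochain k A M (n + 1) :=
  MultilinearMap.mk' (fun a => a 0 • c (Fin.tail a))
    (fun a m x y => by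
      cases m using Fin.cases with
      | zero => simp [add_smul]
      | succ m =>
        have h (z : A) : Function.update a m.succ z 0 = a 0 :=
          Function.update_of_ne (Fin.succ_ne_zero m).symm _ _
        simp only [h, Fin.tail_update_succ, c.map_update_add, smul_add])
    (fun a m t x => by
      cases m using Fin.cases with
      | zero => simp
      | succ m =>
        have h (z : A) : Function.update a m.succ z 0 = a 0 :=
          Function.update_of_ne (Fin.succ_ne_zero m).symm _ _
        have : SMulCommClass k A M := IsScalarTower.to_smulCommClass
        simp only [h, Fin.tail_update_succ, c.map_update_smul, smul_comm t])

/-- The last term `c(a₀, …, a_{n-1}) · a_n` of the Hochschild differential. -/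
def hochschildLast {n : ℕ} (c : HochschildCochain k A M n) : HochschildCochain k A M (n + 1) :=
  MultilinearMap.mk' (fun a => MulOpposite.op (a (Fin.last n)) • c (Fin.init a))
    (fun a m x y => by
      cases m using Fin.lastCases with
      | last => simp [add_smul]
      | cast m =>
        have h (z : A) : Function.update a m.castSucc z (Fin.last n) = a (Fin.last n) :=
          Function.update_of_ne (Fin.castSucc_lt_last m).ne' _ _
        simp only [h, Fin.init_update_castSucc, c.map_update_add, smul_add])
    (fun a m t x => by
      cases m using Fin.lastCases with
      | last => simp
      | cast m =>
        have h (z : A) : Function.update a m.castSucc z (Fin.last n) = a (Fin.last n) :=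
          Function.update_of_ne (Fin.castSucc_lt_last m).ne' _ _
        have : SMulCommClass k Aᵐᵒᵖ M := IsScalarTower.to_smulCommClass
        simp only [h, Fin.init_update_castSucc, c.map_update_smul, smul_comm t])

variable (k A M)

/-- The Hochschild differential `C^n(A, M) → C^{n+1}(A, M)`:
`(dc)(a₀, …, a_n) = a₀ c(a₁, …, a_n) + ∑_j (-1)^{j+1} c(…, a_j a_{j+1}, …)
  + (-1)^{n+1} c(a₀, …, a_{n-1}) a_n`. -/
def hochschildD (n : ℕ) : HochschildCochain k A M n →ₗ[k] HochschildCochain k A M (n + 1) where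
  toFun c := hochschildFirst c
    + ∑ j : Fin n, (-1 : k) ^ ((j : ℕ) + 1) • hochschildInner j c
    + (-1 : k) ^ (n + 1) • hochschildLast c
  map_add' c c' := by
    ext a
    simp [hochschildFirst, hochschildInner, hochschildLast, Finset.sum_add_distrib]
    abel
  map_smul' t c := by
    ext a
    have : SMulCommClass k A M := IsScalarTower.to_smulCommClass
    have : SMulCommClass k Aᵐᵒᵖ M := IsScalarTower.to_smulCommClass
    simp [hochschildFirst, hochschildInner, hochschildLast, Finset.smul_sum, smul_comm t]

/-- Hochschild `n`-cocycles. -/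
def hochschildCocycles (n : ℕ) : Submodule k (HochschildCochain k A M n) :=
  LinearMap.ker (hochschildD k A M n)

/-- Hochschild `n`-coboundaries. -/
def hochschildCoboundaries : (n : ℕ) → Submodule k (HochschildCochain k A M n)
  | 0 => ⊥
  | n + 1 => LinearMap.range (hochschildD k A M n)

/-- The Hochschild cohomology `H^n(A, M)`: cocycles modulo coboundaries. -/
abbrev HochschildCohomology (n : ℕ) : Type _ :=
  hochschildCocycles k A M n ⧸
    (hochschildCoboundaries k A M n).submoduleOf (hochschildCocycles k A M n)

/-- The class of a cocycle in Hochschild cohomology. -/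
def hochschildClass (n : ℕ) : hochschildCocycles k A M n →ₗ[k] HochschildCohomology k A M n :=
  Submodule.mkQ _

variable {k A M}
variable {N : Type*} [AddCommGroup N] [Module k N] [Module A N] [Module Aᵐᵒᵖ N]
  [IsScalarTower k A N] [IsScalarTower k Aᵐᵒᵖ N]

/-- A `k`-linear map of `A`-bimodules: it respects the left and the right action of `A`. -/
structure BimoduleHom (k A M N : Type*) [CommRing k] [Ring A] [Algebra k A]
    [AddCommGroup M] [Module k M] [Module A M] [Module Aᵐᵒᵖ M]
    [AddCommGroup N] [Module k N] [Module A N] [Module Aᵐᵒᵖ N] where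
  toLinearMap : M →ₗ[k] N
  map_left : ∀ (a : A) (m : M), toLinearMap (a • m) = a • toLinearMap m
  map_right : ∀ (a : A) (m : M),
    toLinearMap (MulOpposite.op a • m) = MulOpposite.op a • toLinearMap m

/-- Composition of Hochschild cochains with a map of coefficients. -/
def hochschildCochainMap (f : BimoduleHom k A M N) (n : ℕ) :
    HochschildCochain k A M n →ₗ[k] HochschildCochain k A N n where
  toFun c := f.toLinearMap.compMultilinearMap c
  map_add' c c' := by ext; simp
  map_smul' t c := by ext; simp

theorem hochschildD_map (f : BimoduleHom k A M N) (n : ℕ) (c : HochschildCochain k A M n) :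
    hochschildD k A N n (hochschildCochainMap f n c) =
      hochschildCochainMap f (n + 1) (hochschildD k A M n c) := by
  ext a
  simp [hochschildD, hochschildCochainMap, hochschildFirst, hochschildInner, hochschildLast,
    f.map_left, f.map_right]

/-- The map induced on cocycles by a map of coefficients. -/
def hochschildCocyclesMap (f : BimoduleHom k A M N) (n : ℕ) :
    hochschildCocycles k A M n →ₗ[k] hochschildCocycles k A N n :=
  (hochschildCochainMap f n).restrict fun c hc => by
    rw [hochschildCocycles, LinearMap.mem_ker] at hc ⊢
    rw [hochschildD_map, hc, map_zero]

/-- The map `H^n(A, M) → H^n(A, N)` induced by a bimodule map `M → N`. -/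
def hochschildMap (f : BimoduleHom k A M N) (n : ℕ) :
    HochschildCohomology k A M n →ₗ[k] HochschildCohomology k A N n :=
  Submodule.mapQ _ _ (hochschildCocyclesMap f n) <| by
    intro c hc
    change c.1 ∈ hochschildCoboundaries k A M n at hc
    change hochschildCochainMap f n c.1 ∈ hochschildCoboundaries k A N n
    cases n with
    | zero =>
      rw [hochschildCoboundaries, Submodule.mem_bot] at hc ⊢
      rw [hc, map_zero]
    | succ n =>
      obtain ⟨b, hb⟩ := hc
      exact ⟨hochschildCochainMap f n b, by rw [hochschildD_map, hb]⟩

end Hochschild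

/-! ### Bimodules obtained from a pair of algebra homomorphisms -/

section PullbackBimodule

variable {k A S : Type*} [CommRing k] [CommRing A] [Algebra k A] [CommRing S] [Algebra k S]

/-- For algebra homomorphisms `l r : A → S`, the `k`-module `S` as an `A`-bimodule with
`a · s · b = l a * s * r b`. -/
def PullbackBimodule (_l _r : A →ₐ[k] S) : Type _ := S

namespace PullbackBimodule

variable (l r : A →ₐ[k] S)

instance : AddCommGroup (PullbackBimodule l r) := inferInstanceAs (AddCommGroup S)

instance : Module k (PullbackBimodule l r) := inferInstanceAs (Module k S)

/-- The identity map from `S` to the bimodule. -/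
def of : S ≃ₗ[k] PullbackBimodule l r := LinearEquiv.refl k S

noncomputable instance : Module A (PullbackBimodule l r) where
  smul a s := of l r (l a * (of l r).symm s)
  one_smul s := by change of l r (l 1 * _) = s; simp
  mul_smul a b s := by
    change of l r (l (a * b) * _) = of l r (l a * (of l r).symm (of l r (l b * _)))
    simp [mul_assoc]
  smul_zero a := by change of l r (l a * (of l r).symm 0) = 0; simp
  smul_add a s t := by
    change of l r (l a * (of l r).symm (s + t)) = of l r (l a * _) + of l r (l a * _)
    simp [mul_add]
  add_smul a b s := by
    change of l r (l (a + b) * _) = of l r (l a * _) + of l r (l b * _)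
    simp [add_mul]
  zero_smul s := by change of l r (l 0 * _) = 0; simp

noncomputable instance : Module Aᵐᵒᵖ (PullbackBimodule l r) where
  smul a s := of l r ((of l r).symm s * r a.unop)
  one_smul s := by change of l r (_ * r 1) = s; simp
  mul_smul a b s := by
    change of l r (_ * r (b.unop * a.unop)) = of l r ((of l r).symm (of l r (_ * r b.unop)) * r a.unop)
    simp [mul_assoc]
  smul_zero a := by change of l r ((of l r).symm 0 * r a.unop) = 0; simp
  smul_add a s t := by
    change of l r ((of l r).symm (s + t) * r a.unop) = of l r (_ * r a.unop) + of l r (_ * r a.unop)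
    simp [add_mul]
  add_smul a b s := by
    change of l r (_ * r (a.unop + b.unop)) = of l r (_ * r a.unop) + of l r (_ * r b.unop)
    simp [mul_add]
  zero_smul s := by change of l r (_ * r 0) = 0; simp

theorem smul_of (a : A) (s : S) : a • of l r s = of l r (l a * s) := rfl

theorem op_smul_of (a : A) (s : S) : MulOpposite.op a • of l r s = of l r (s * r a) := rfl

instance : IsScalarTower k A (PullbackBimodule l r) where
  smul_assoc t a s := by
    obtain ⟨s, rfl⟩ := (of l r).surjective s
    rw [smul_of, smul_of, map_smul, smul_mul_assoc, map_smul]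

instance : IsScalarTower k Aᵐᵒᵖ (PullbackBimodule l r) where
  smul_assoc t a s := by
    obtain ⟨s, rfl⟩ := (of l r).surjective s
    induction a using MulOpposite.rec' with
    | _ a => rw [← MulOpposite.op_smul, op_smul_of, op_smul_of, map_smul, mul_smul_comm, map_smul]

instance : SMulCommClass A Aᵐᵒᵖ (PullbackBimodule l r) where
  smul_comm a b s := by
    obtain ⟨s, rfl⟩ := (of l r).surjective s
    induction b using MulOpposite.rec' with
    | _ b => rw [op_smul_of, smul_of, smul_of, op_smul_of, mul_assoc]

end PullbackBimodule

end PullbackBimodule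

/-! ### Polynomial functions on a representation -/

section Polynomial

variable (k : Type*) [Field k] (V : Type*) [AddCommGroup V] [Module k V]

/-- The algebra `k[V]` of polynomial functions on `V`: the symmetric algebra of the dual space.
A basis of `V` identifies it with a polynomial algebra in `dim V` variables. -/
abbrev PolyFun : Type _ := SymmetricAlgebra k (Module.Dual k V)

variable {k V}

/-- Restriction of polynomial functions to a linear subspace. -/
noncomputable def polyRestrict (W : Submodule k V) : PolyFun k V →ₐ[k] PolyFun k W :=
  SymmetricAlgebra.lift (SymmetricAlgebra.ι k (Module.Dual k W) ∘ₗ W.dualRestrict)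

variable {G : Type*} [Group G] (ρ : Representation k G V) (g : G)

/-- The action `a ↦ a^g` of `g` on polynomial functions, `a^g(v) = a(g⁻¹ v)`. -/
noncomputable def polyAct : PolyFun k V →ₐ[k] PolyFun k V :=
  SymmetricAlgebra.lift (SymmetricAlgebra.ι k (Module.Dual k V) ∘ₗ ρ.dual g)

/-- The space `V^g` of `g`-invariant vectors. -/
def fixedSpace : Submodule k V := LinearMap.eqLocus (ρ g) LinearMap.id

/-- The complement of `V^g` (written `(V^g)^∨`): the subspace spanned by the eigenvectors of `g`
with eigenvalue different from one. -/
def movedSpace : Submodule k V := ⨆ (μ : k) (_ : μ ≠ 1), Module.End.eigenspace (ρ g) μ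

/-- The codimension `d_g` of `V^g` in `V`. -/
noncomputable def fixedCodim : ℕ := Module.finrank k (V ⧸ fixedSpace ρ g)

/-- The `k[V]`-bimodule `k[V]g = {b g}` inside the crossed product `k[G] ⋉ k[V]`, in which
`g c = c^g g`. Writing `b` for `b g`, it is `k[V]` with `a · b · c = a b c^g`. -/
abbrev TwistedBimodule : Type _ := PullbackBimodule (AlgHom.id k (PolyFun k V)) (polyAct ρ g)

/-- The action of `G` on `k[V]` by algebra automorphisms. -/
@[reducible] noncomputable def polyMulSemiringAction : MulSemiringAction G (PolyFun k V) where
  smul h a := polyAct ρ h a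
  one_smul a := by
    have h : polyAct ρ 1 = AlgHom.id k _ := by
      apply SymmetricAlgebra.algHom_ext
      refine LinearMap.ext fun φ => ?_
      change polyAct ρ 1 (SymmetricAlgebra.ι k _ φ) = SymmetricAlgebra.ι k _ φ
      simp only [polyAct, SymmetricAlgebra.lift_ι_apply, LinearMap.comp_apply, map_one]
      rfl
    exact DFunLike.congr_fun h a
  mul_smul x y a := by
    have h : polyAct ρ (x * y) = (polyAct ρ x).comp (polyAct ρ y) := by
      apply SymmetricAlgebra.algHom_ext
      refine LinearMap.ext fun φ => ?_
      change polyAct ρ (x * y) (SymmetricAlgebra.ι k _ φ) =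
        polyAct ρ x (polyAct ρ y (SymmetricAlgebra.ι k _ φ))
      simp only [polyAct, SymmetricAlgebra.lift_ι_apply, LinearMap.comp_apply, map_mul,
        Module.End.mul_apply]
    exact DFunLike.congr_fun h a
  smul_zero h := map_zero (polyAct ρ h)
  smul_add h := map_add (polyAct ρ h)
  smul_one h := map_one (polyAct ρ h)
  smul_mul h := map_mul (polyAct ρ h)

/-- In the crossed product `k[G] ⋉ k[V]`, realised as the skew group algebra, the bimodule
structure on `k[V]g = {b g}` is the one of `TwistedBimodule`: `a (b g) c = (a · b · c) g`. -/
theorem crossedProduct_mul (a b c : PolyFun k V) :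
    letI := polyMulSemiringAction ρ
    (SkewMonoidAlgebra.single 1 a * SkewMonoidAlgebra.single g b * SkewMonoidAlgebra.single 1 c :
        SkewMonoidAlgebra (PolyFun k V) G) =
      SkewMonoidAlgebra.single g ((PullbackBimodule.of _ _).symm
        (a • MulOpposite.op c • (PullbackBimodule.of _ _ b : TwistedBimodule ρ g))) := by
  let _ := polyMulSemiringAction ρ
  rw [PullbackBimodule.op_smul_of, PullbackBimodule.smul_of, LinearEquiv.symm_apply_apply,
    SkewMonoidAlgebra.single_mul_single, SkewMonoidAlgebra.single_mul_single, one_smul, one_mul,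
    mul_one, mul_assoc]
  rfl

/-- The algebra `k[W]` as a `k[V]`-bimodule through restriction of functions. -/
abbrev RestrictedBimodule (W : Submodule k V) : Type _ :=
  PullbackBimodule (polyRestrict W) (polyRestrict W)

theorem polyRestrict_polyAct (c : PolyFun k V) :
    polyRestrict (fixedSpace ρ g) (polyAct ρ g c) = polyRestrict (fixedSpace ρ g) c := by
  have h : (polyRestrict (fixedSpace ρ g)).comp (polyAct ρ g) = polyRestrict (fixedSpace ρ g) := by
    apply SymmetricAlgebra.algHom_ext
    refine LinearMap.ext fun φ => ?_
    change polyRestrict (fixedSpace ρ g) (polyAct ρ g (SymmetricAlgebra.ι k _ φ)) =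
      polyRestrict (fixedSpace ρ g) (SymmetricAlgebra.ι k _ φ)
    simp only [polyAct, polyRestrict, SymmetricAlgebra.lift_ι_apply, LinearMap.comp_apply]
    congr 1
    refine LinearMap.ext fun v => ?_
    change φ (ρ g⁻¹ v) = φ v
    have hv : ρ g v = v := v.2
    conv_lhs => rw [← hv]
    simp
  exact DFunLike.congr_fun h c

/-- The bimodule map `k[V]g → k[V^g]g ≅ k[V^g]`, `b g ↦ b|_{V^g}`. -/
noncomputable def twistedRestrict :
    BimoduleHom k (PolyFun k V) (TwistedBimodule ρ g) (RestrictedBimodule (fixedSpace ρ g)) where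
  toLinearMap := (PullbackBimodule.of _ _).toLinearMap ∘ₗ
    (polyRestrict (fixedSpace ρ g)).toLinearMap ∘ₗ (PullbackBimodule.of _ _).symm.toLinearMap
  map_left a m := by
    obtain ⟨m, rfl⟩ := (PullbackBimodule.of _ _).surjective m
    simp [PullbackBimodule.smul_of]
  map_right a m := by
    obtain ⟨m, rfl⟩ := (PullbackBimodule.of _ _).surjective m
    simp [PullbackBimodule.op_smul_of, polyRestrict_polyAct]

end Polynomial

/-! ### Exterior powers -/

section Exterior

variable {k : Type*} [Field k] {V : Type*} [AddCommGroup V] [Module k V]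

/-- The wedge product `Λ^p V × Λ^q V → Λ^{p+q} V`. -/
noncomputable def wedge (p q : ℕ) : ⋀[k]^p V →ₗ[k] ⋀[k]^q V →ₗ[k] ⋀[k]^(p + q) V :=
  LinearMap.mk₂ k
    (fun x y => ⟨(x : ExteriorAlgebra k V) * (y : ExteriorAlgebra k V),
      SetLike.mul_mem_graded x.2 y.2⟩)
    (fun _ _ _ => Subtype.ext (add_mul _ _ _))
    (fun _ _ _ => Subtype.ext (smul_mul_assoc _ _ _))
    (fun _ _ _ => Subtype.ext (mul_add _ _ _))
    (fun _ _ _ => Subtype.ext (mul_smul_comm _ _ _))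

/-- The natural map `Λ^p U ⊗ Λ^q W → Λ^{p+q} V`, `ξ ⊗ ω ↦ ξ ∧ ω`, for subspaces `U, W` of `V`. -/
noncomputable def wedgeSub (U W : Submodule k V) (p q : ℕ) :
    ⋀[k]^p U ⊗[k] ⋀[k]^q W →ₗ[k] ⋀[k]^(p + q) V :=
  TensorProduct.lift
    ((wedge p q).compl₁₂ (exteriorPower.map p U.subtype) (exteriorPower.map q W.subtype))

/-- The map `Λ^i V ⊗ F → F` pairing multivectors with `y₁ ∧ ⋯ ∧ y_i`, where `y_j ∈ V*`:
`(v₁ ∧ ⋯ ∧ v_i) ⊗ f ↦ det(y_j(v_l)) f`. -/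
noncomputable def contractWith (F : Type*) [AddCommGroup F] [Module k F] {i : ℕ}
    (y : Fin i → Module.Dual k V) : (⋀[k]^i V) ⊗[k] F →ₗ[k] F :=
  (TensorProduct.lid k F).toLinearMap ∘ₗ
    LinearMap.rTensor F (exteriorPower.pairingDual k V i (exteriorPower.ιMulti k i y))

end Exterior

/-!
The proof compares Hochschild cochains of `A = k[V]` with the Koszul complex of alternating maps
`Λ^n V* → M` whose differential is built from the commutators `m ↦ y m - m y`, `y ∈ V*`.
Antisymmetrization on linear functions is a morphism of complexes
(`antisymmetrize_hochschildD`), natural in the bimodule `M`, and the first half of the file shows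
that it is bijective on cohomology for every `M` (`antisymmetrizeBijective_symmetricAlgebra`).

This goes by dimension shifting. Every bimodule embeds into the coinduced bimodule `Hom_k(A, M)`,
which has no Hochschild cohomology in positive degrees
(`exists_hochschildD_eq_of_coinduced`). It has no Koszul cohomology
there either: the commutator with a coordinate `y` has a right inverse that commutes with the
commutators with the other coordinates, obtained by solving `y F(p) - F(y p) = f(p)` degree by
degree in `y` (`coinducedInverse`), and each of these yields a contracting homotopy
(`exists_koszul_homotopic`, `exists_koszulD_eq_of_rightInverse`). Degree `n + 1` for `M` then
follows from degree `n` for the quotient (`antisymmetrizeBijective_of_coinduced`), and degree zero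
is the centre of the bimodule on both sides.

For `M = k[U]` all commutators vanish, so the Koszul complex has zero differential and the
cohomology is the space of alternating maps `Λ^n V* → k[U]`, which contraction identifies with
`Λ^n V ⊗ k[U]`: this is `restrictedCohomologyEquiv`.

For `M = k[V]g`, the order of `G` is invertible in `k`, so `g` is diagonalizable and there is a
basis of `V` adapted to `V = V^g ⊕ (V^g)^∨` (`exists_adaptedBasis`). The commutator with an
invariant coordinate is zero, and with a moved coordinate it is a nonzero multiple of
multiplication by it, with left inverse the division by that coordinate. The corresponding
homotopies make every Koszul cocycle cohomologous to one that is supported on tuples containing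
all the moved coordinates, with values independent of these
(`AdaptedBasis.exists_koszul_homologous`). Such cocycles are determined by their restriction to
`V^g`, and conversely every alternating map to `k[V^g]` with this support extends. Hence
`H^n(k[V], k[V]g) → H^n(k[V], k[V^g]) ≅ Λ^n V ⊗ k[V^g]` is injective, and its image is that of
`Λ^{n-d} V^g ⊗ Λ^d (V^g)^∨ ⊗ k[V^g]` (`AdaptedBasis.range_restrictedCohomologyEquiv_comp`).
-/

/-! ### The coinduced bimodule and the square of the Hochschild differential -/

section Coinduced

/-- The coinduced bimodule `Hom_k(A, M)` of a left `A`-module `M`, with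
`(a f)(c) = a f(c)` and `(f b)(c) = f(b c)`. -/
def CoinducedBimodule (k A M : Type*) [CommRing k] [Ring A] [Algebra k A]
    [AddCommGroup M] [Module k M] : Type _ := A →ₗ[k] M

variable {k : Type*} [CommRing k] {A : Type*} [Ring A] [Algebra k A]
variable {M : Type*} [AddCommGroup M] [Module k M]

namespace CoinducedBimodule

instance : AddCommGroup (CoinducedBimodule k A M) := inferInstanceAs (AddCommGroup (A →ₗ[k] M))

instance : Module k (CoinducedBimodule k A M) := inferInstanceAs (Module k (A →ₗ[k] M))

instance : FunLike (CoinducedBimodule k A M) A M := inferInstanceAs (FunLike (A →ₗ[k] M) A M)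

instance : LinearMapClass (CoinducedBimodule k A M) k A M :=
  inferInstanceAs (LinearMapClass (A →ₗ[k] M) k A M)

@[ext]
theorem ext {f f' : CoinducedBimodule k A M} (h : ∀ c, f c = f' c) : f = f' := LinearMap.ext h

@[simp]
theorem add_apply (f f' : CoinducedBimodule k A M) (c : A) : (f + f') c = f c + f' c := rfl

@[simp]
theorem smul_apply (t : k) (f : CoinducedBimodule k A M) (c : A) : (t • f) c = t • f c := rfl

@[simp]
theorem zero_apply (c : A) : (0 : CoinducedBimodule k A M) c = 0 := rfl

instance : Module Aᵐᵒᵖ (CoinducedBimodule k A M) where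
  smul b f := LinearMap.comp (f : A →ₗ[k] M) (LinearMap.mulLeft k b.unop)
  one_smul f := ext fun c => congrArg f (one_mul c)
  mul_smul b b' f := ext fun c => congrArg f (mul_assoc b'.unop b.unop c)
  smul_zero _ := rfl
  smul_add _ _ _ := rfl
  add_smul b b' f := ext fun c => (congrArg f (add_mul b.unop b'.unop c)).trans (map_add f _ _)
  zero_smul f := ext fun c => (congrArg f (zero_mul c)).trans (map_zero f)

@[simp]
theorem op_smul_apply (b : A) (f : CoinducedBimodule k A M) (c : A) :
    (MulOpposite.op b • f) c = f (b * c) := rfl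

variable [Module A M] [IsScalarTower k A M]

instance : Module A (CoinducedBimodule k A M) :=
  have : SMulCommClass k A M := IsScalarTower.to_smulCommClass
  have : SMulCommClass A k M := SMulCommClass.symm _ _ _
  inferInstanceAs (Module A (A →ₗ[k] M))

@[simp]
theorem left_smul_apply (a : A) (f : CoinducedBimodule k A M) (c : A) : (a • f) c = a • f c := rfl

instance : IsScalarTower k A (CoinducedBimodule k A M) where
  smul_assoc t a f := ext fun c => smul_assoc t a (f c)

instance : IsScalarTower k Aᵐᵒᵖ (CoinducedBimodule k A M) where
  smul_assoc t b f := ext fun c =>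
    (congrArg f (smul_mul_assoc t b.unop c)).trans (map_smul f t _)

instance : SMulCommClass A Aᵐᵒᵖ (CoinducedBimodule k A M) where
  smul_comm _ _ _ := rfl

end CoinducedBimodule

/-- Regarding the last argument of a cochain as the argument of a coinduced value. -/
def hochschildCurry {n : ℕ} (f : HochschildCochain k A M (n + 1)) :
    HochschildCochain k A (CoinducedBimodule k A M) n :=
  MultilinearMap.curryRight f

theorem hochschildCurry_apply {n : ℕ} (f : HochschildCochain k A M (n + 1)) (a : Fin n → A)
    (c : A) : hochschildCurry f a c = f (Fin.snoc a c) := rfl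

theorem hochschildCurry_injective {n : ℕ} :
    Function.Injective (hochschildCurry (k := k) (A := A) (M := M) (n := n)) := fun f f' h => by
  ext a
  have := DFunLike.congr_fun (DFunLike.congr_fun h (Fin.init a)) (a (Fin.last n))
  rwa [hochschildCurry_apply, hochschildCurry_apply, Fin.snoc_init_self] at this

variable [Module A M] [IsScalarTower k A M]

/-- The Hochschild differential without the term that uses the right action. -/
def hochschildLeftD {n : ℕ} (c : HochschildCochain k A M n) : HochschildCochain k A M (n + 1) :=
  hochschildFirst c + ∑ j : Fin n, (-1 : k) ^ ((j : ℕ) + 1) • hochschildInner j c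

theorem contractNth_snoc {n : ℕ} (j : Fin n) (a : Fin (n + 1) → A) (c : A) :
    Fin.contractNth j.castSucc.castSucc (· * ·) (Fin.snoc a c : Fin (n + 2) → A) =
      (Fin.snoc (Fin.contractNth j.castSucc (· * ·) a) c : Fin (n + 1) → A) := by
  funext i
  cases i using Fin.lastCases with
  | last =>
    rw [Fin.snoc_last, Fin.contractNth_apply_of_gt _ _ _ _ (by simp), Fin.succ_last, Fin.snoc_last]
  | cast i =>
    rw [Fin.snoc_castSucc]
    rcases Nat.lt_trichotomy (i : ℕ) j with h | h | h
    · rw [Fin.contractNth_apply_of_lt _ _ _ _ (by simpa), Fin.snoc_castSucc,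
        Fin.contractNth_apply_of_lt _ _ _ _ (by simpa)]
    · rw [Fin.contractNth_apply_of_eq _ _ _ _ (by simpa), Fin.snoc_castSucc, Fin.succ_castSucc,
        Fin.snoc_castSucc, Fin.contractNth_apply_of_eq _ _ _ _ (by simpa)]
    · rw [Fin.contractNth_apply_of_gt _ _ _ _ (by simpa), Fin.succ_castSucc, Fin.snoc_castSucc,
        Fin.contractNth_apply_of_gt _ _ _ _ (by simpa)]

theorem contractNth_last_snoc {n : ℕ} (a : Fin (n + 1) → A) (c : A) :
    Fin.contractNth (Fin.last n).castSucc (· * ·) (Fin.snoc a c : Fin (n + 2) → A) =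
      (Fin.snoc (Fin.init a) (a (Fin.last n) * c) : Fin (n + 1) → A) := by
  funext i
  cases i using Fin.lastCases with
  | last =>
    rw [Fin.snoc_last, Fin.contractNth_apply_of_eq _ _ _ _ (by simp), Fin.succ_last, Fin.snoc_last,
      Fin.snoc_castSucc]
  | cast i =>
    rw [Fin.snoc_castSucc, Fin.contractNth_apply_of_lt _ _ _ _ (by simp), Fin.snoc_castSucc]
    rfl

/-- Passing to coinduced values turns the truncated differential into the full one, since the
right action on coinduced values multiplies into the last argument. -/
theorem hochschildCurry_leftD {n : ℕ} (f : HochschildCochain k A M (n + 1)) :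
    hochschildCurry (hochschildLeftD f) =
      hochschildD k A (CoinducedBimodule k A M) n (hochschildCurry f) := by
  ext a c
  have h1 : Fin.tail (Fin.snoc a c : Fin (n + 2) → A) = Fin.snoc (Fin.tail a) c := by
    funext i
    cases i using Fin.lastCases with
    | last => simp [Fin.tail, Fin.succ_last]
    | cast i => simp only [Fin.tail, Fin.succ_castSucc, Fin.snoc_castSucc]
  have h2 : (Fin.snoc a c : Fin (n + 2) → A) 0 = a 0 := by
    rw [← Fin.castSucc_zero, Fin.snoc_castSucc]
  rw [hochschildCurry_apply]
  simp only [hochschildLeftD, hochschildD, LinearMap.coe_mk, AddHom.coe_mk, Fin.sum_univ_castSucc,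
    _root_.add_apply, CoinducedBimodule.add_apply, hochschildFirst, hochschildInner,
    hochschildLast, MultilinearMap.mk'_apply, CoinducedBimodule.left_smul_apply,
    CoinducedBimodule.op_smul_apply, hochschildCurry_apply, _root_.smul_apply,
    CoinducedBimodule.smul_apply, _root_.sum_apply, h1, h2, contractNth_snoc,
    contractNth_last_snoc, Fin.val_castSucc, Fin.val_last, ← add_assoc]
  congr 2
  have (s : Finset (Fin n)) (F : Fin n → CoinducedBimodule k A M) :
      (∑ i ∈ s, F i) c = ∑ i ∈ s, F i c := LinearMap.sum_apply _ _ _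
  rw [this]
  rfl

variable [Module Aᵐᵒᵖ M] [IsScalarTower k Aᵐᵒᵖ M]

/-- The embedding `M → Hom_k(A, M)`, `m ↦ (c ↦ m c)`. -/
def toCoinduced [SMulCommClass A Aᵐᵒᵖ M] : BimoduleHom k A M (CoinducedBimodule k A M) where
  toLinearMap :=
    { toFun m :=
        { toFun c := MulOpposite.op c • m
          map_add' c c' := by rw [MulOpposite.op_add, add_smul]
          map_smul' t c := by rw [MulOpposite.op_smul, smul_assoc, RingHom.id_apply] }
      map_add' m m' := LinearMap.ext fun c => smul_add _ m m'
      map_smul' t m := LinearMap.ext fun c =>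
        have : SMulCommClass k Aᵐᵒᵖ M := IsScalarTower.to_smulCommClass
        (smul_comm t (MulOpposite.op c) m).symm }
  map_left a m := CoinducedBimodule.ext fun c => (smul_comm a (MulOpposite.op c) m).symm
  map_right b m := CoinducedBimodule.ext fun c => by
    change MulOpposite.op c • MulOpposite.op b • m = MulOpposite.op (b * c) • m
    rw [smul_smul, MulOpposite.op_mul]

@[simp]
theorem toCoinduced_apply [SMulCommClass A Aᵐᵒᵖ M] (m : M) (c : A) :
    (toCoinduced (k := k) (A := A) (M := M)).toLinearMap m c = MulOpposite.op c • m := rfl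

theorem toCoinduced_injective [SMulCommClass A Aᵐᵒᵖ M] :
    Function.Injective (toCoinduced (k := k) (A := A) (M := M)).toLinearMap := fun m m' h => by
  simpa using DFunLike.congr_fun h (1 : A)

theorem hochschildD_eq {n : ℕ} (c : HochschildCochain k A M n) :
    hochschildD k A M n c = hochschildLeftD c + (-1 : k) ^ (n + 1) • hochschildLast c := rfl

theorem hochschildCurry_D [SMulCommClass A Aᵐᵒᵖ M] {n : ℕ}
    (f : HochschildCochain k A M (n + 1)) :
    hochschildCurry (hochschildD k A M (n + 1) f) =
      hochschildD k A (CoinducedBimodule k A M) n (hochschildCurry f) +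
        (-1 : k) ^ n • hochschildCochainMap toCoinduced (n + 1) f := by
  rw [← hochschildCurry_leftD, hochschildD_eq]
  ext a c
  simp only [_root_.add_apply, CoinducedBimodule.add_apply, hochschildCurry_apply,
    _root_.smul_apply, CoinducedBimodule.smul_apply, hochschildLast,
    MultilinearMap.mk'_apply, Fin.init_snoc, Fin.snoc_last]
  rw [pow_add, pow_add]
  simp [hochschildCochainMap]

/-- The square of the Hochschild differential vanishes. The induction on the degree passes to
coinduced values, so it runs over all coefficient bimodules. -/
theorem hochschildD_comp_hochschildD.{u} {k : Type*} [CommRing k] {A : Type u} [Ring A]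
    [Algebra k A] (n : ℕ) :
    ∀ {M : Type u} [AddCommGroup M] [Module k M] [Module A M] [Module Aᵐᵒᵖ M]
    [IsScalarTower k A M] [IsScalarTower k Aᵐᵒᵖ M] [SMulCommClass A Aᵐᵒᵖ M]
    (c : HochschildCochain k A M n),
    hochschildD k A M (n + 1) (hochschildD k A M n c) = 0 := by
  induction n with
  | zero =>
    intro M _ _ _ _ _ _ _ c
    ext a
    simp [hochschildD, hochschildFirst, hochschildInner, hochschildLast, Fin.contractNth,
      Fin.tail, Fin.init, mul_smul]
    have h (x : Fin 0 → A) : c x = c ![] := congrArg c (Subsingleton.elim _ _)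
    simp only [h, smul_comm (a 0) (MulOpposite.op (a 1))]
    abel
  | succ n ih =>
    intro M _ _ _ _ _ _ _ c
    apply hochschildCurry_injective
    rw [hochschildCurry_D, hochschildCurry_D, map_add, ih, map_smul, zero_add, hochschildD_map,
      pow_succ, mul_neg_one, neg_smul, add_neg_cancel]
    rfl

omit [Module Aᵐᵒᵖ M] [IsScalarTower k Aᵐᵒᵖ M] in
/-- Coinduced bimodules have no Hochschild cohomology in positive degrees. -/
theorem exists_hochschildD_eq_of_coinduced {n : ℕ}
    (F : HochschildCochain k A (CoinducedBimodule k A M) (n + 1))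
    (hF : hochschildD k A _ (n + 1) F = 0) :
    ∃ H, hochschildD k A (CoinducedBimodule k A M) n H = F := by
  let ev : CoinducedBimodule k A M →ₗ[k] M := LinearMap.applyₗ (1 : A)
  let f : HochschildCochain k A M (n + 1) := ev.compMultilinearMap F
  have h : hochschildD k A _ n (hochschildCurry f) + (-1 : k) ^ n • F = 0 := by
    rw [← hochschildCurry_leftD]
    ext a c
    have := DFunLike.congr_fun (DFunLike.congr_fun hF (Fin.snoc a c)) (1 : A)
    rw [hochschildD_eq] at this
    have h' (b : Fin (n + 2) → A) : hochschildLeftD F b 1 = hochschildLeftD f b := by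
      simp only [hochschildLeftD, hochschildFirst, hochschildInner, _root_.add_apply,
        _root_.smul_apply, _root_.sum_apply, CoinducedBimodule.add_apply,
        MultilinearMap.mk'_apply, CoinducedBimodule.left_smul_apply]
      congr 1
      exact map_sum ev _ _
    rw [_root_.add_apply, CoinducedBimodule.add_apply, h'] at this
    simp only [hochschildLast, _root_.smul_apply, CoinducedBimodule.smul_apply,
      MultilinearMap.mk'_apply, Fin.snoc_last, Fin.init_snoc, CoinducedBimodule.op_smul_apply,
      mul_one, pow_succ] at this
    simpa [hochschildCurry_apply] using this
  refine ⟨(-1 : k) ^ (n + 1) • hochschildCurry f, ?_⟩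
  rw [map_smul, eq_neg_of_add_eq_zero_left h, pow_succ, mul_neg_one, neg_smul, smul_neg, neg_neg,
    smul_smul, ← mul_pow, neg_one_mul, neg_neg, one_pow, one_smul]

end Coinduced

/-! ### Koszul cochains and antisymmetrization -/

section Koszul

variable {k : Type*} [CommRing k] {A : Type*} [CommRing A] [Algebra k A]
variable {W : Type*} [AddCommGroup W] [Module k W] (x : W →ₗ[k] A)
variable (M : Type*) [AddCommGroup M] [Module k M] [Module A M] [Module Aᵐᵒᵖ M]
  [IsScalarTower k A M] [IsScalarTower k Aᵐᵒᵖ M]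
variable {N : Type*} [AddCommGroup N] [Module k N] [Module A N] [Module Aᵐᵒᵖ N]
  [IsScalarTower k A N] [IsScalarTower k Aᵐᵒᵖ N]

/-- The commutator `m ↦ x(w) m - m x(w)` of a bimodule with the elements of a linear family
`x : W → A`. -/
def commutatorMap : W →ₗ[k] M →ₗ[k] M :=
  have : SMulCommClass k A M := IsScalarTower.to_smulCommClass
  have : SMulCommClass k Aᵐᵒᵖ M := IsScalarTower.to_smulCommClass
  LinearMap.mk₂ k (fun w m => x w • m - MulOpposite.op (x w) • m)
    (fun w w' m => by simp only [map_add, MulOpposite.op_add, add_smul]; abel)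
    (fun t w m => by simp only [map_smul, MulOpposite.op_smul, smul_assoc, smul_sub])
    (fun w m m' => by simp only [smul_add]; abel)
    (fun t w m => by simp only [smul_sub, smul_comm t])

theorem commutatorMap_apply (w : W) (m : M) :
    commutatorMap x M w m = x w • m - MulOpposite.op (x w) • m := rfl

/-- The Koszul differential on alternating maps `W × ⋯ × W → M`:
`(dκ)(w₀, …, w_n) = ∑_i (-1)^i [x(w_i), κ(…, ŵ_i, …)]`. -/
def koszulD (n : ℕ) : (W [⋀^Fin n]→ₗ[k] M) →ₗ[k] (W [⋀^Fin (n + 1)]→ₗ[k] M) :=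
  AlternatingMap.alternatizeUncurryFinLM ∘ₗ LinearMap.mk₂ k
    (fun κ w => (commutatorMap x M w).compAlternatingMap κ)
    (fun κ κ' w => LinearMap.compAlternatingMap_add _ κ κ')
    (fun t κ w => LinearMap.compAlternatingMap_smul _ t κ)
    (fun κ w w' => by rw [map_add]; rfl)
    (fun t κ w => by rw [map_smul]; rfl)

variable {M}

theorem koszulD_apply {n : ℕ} (κ : W [⋀^Fin n]→ₗ[k] M) (v : Fin (n + 1) → W) :
    koszulD x M n κ v =
      ∑ i : Fin (n + 1), (-1 : ℤ) ^ (i : ℕ) • commutatorMap x M (v i) (κ (i.removeNth v)) :=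
  AlternatingMap.alternatizeUncurryFin_apply _ _

theorem koszulD_comp_koszulD [SMulCommClass A Aᵐᵒᵖ M] (n : ℕ) (κ : W [⋀^Fin n]→ₗ[k] M) :
    koszulD x M (n + 1) (koszulD x M n κ) = 0 := by
  let f : W →ₗ[k] W →ₗ[k] W [⋀^Fin n]→ₗ[k] M := LinearMap.mk₂ k
    (fun w w' => (commutatorMap x M w ∘ₗ commutatorMap x M w').compAlternatingMap κ)
    (fun w₁ w₂ w' => by ext; simp)
    (fun t w w' => by ext; simp)
    (fun w w₁ w₂ => by ext; simp)
    (fun t w w' => by ext; simp)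
  have hf (w w' : W) : f w w' = f w' w := by
    ext v
    simp only [f, LinearMap.mk₂_apply, LinearMap.compAlternatingMap_apply, LinearMap.comp_apply,
      commutatorMap_apply, smul_sub, smul_comm (x w) (MulOpposite.op (x w')),
      smul_comm (x w') (MulOpposite.op (x w)), smul_comm (x w) (x w'),
      smul_comm (MulOpposite.op (x w)) (MulOpposite.op (x w'))]
    abel
  rw [← AlternatingMap.alternatizeUncurryFin_alternatizeUncurryFinLM_comp_of_symmetric hf]
  change AlternatingMap.alternatizeUncurryFin _ = _
  congr 1
  ext w v
  simp only [LinearMap.mk₂_apply, LinearMap.compAlternatingMap_apply, LinearMap.comp_apply,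
    koszulD_apply, AlternatingMap.alternatizeUncurryFinLM_apply,
    AlternatingMap.alternatizeUncurryFin_apply, map_sum, map_zsmul, f]

variable (M) in
/-- Koszul coboundaries. -/
def koszulCoboundaries : (n : ℕ) → Submodule k (W [⋀^Fin n]→ₗ[k] M)
  | 0 => ⊥
  | n + 1 => LinearMap.range (koszulD x M n)

theorem koszulD_eq_zero_of_mem_coboundaries [SMulCommClass A Aᵐᵒᵖ M] {n : ℕ}
    {κ : W [⋀^Fin n]→ₗ[k] M} (h : κ ∈ koszulCoboundaries x M n) : koszulD x M n κ = 0 := by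
  cases n with
  | zero => rw [(Submodule.mem_bot k).1 h, map_zero]
  | succ n => obtain ⟨κ, rfl⟩ := h; exact koszulD_comp_koszulD x n κ

theorem koszulD_map (f : BimoduleHom k A M N) {n : ℕ} (κ : W [⋀^Fin n]→ₗ[k] M) :
    koszulD x N n (f.toLinearMap.compAlternatingMap κ) =
      f.toLinearMap.compAlternatingMap (koszulD x M n κ) := by
  ext v
  simp [koszulD_apply, commutatorMap_apply, f.map_left, f.map_right]

theorem map_mem_koszulCoboundaries (f : BimoduleHom k A M N) {n : ℕ} {κ : W [⋀^Fin n]→ₗ[k] M}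
    (h : κ ∈ koszulCoboundaries x M n) :
    f.toLinearMap.compAlternatingMap κ ∈ koszulCoboundaries x N n := by
  cases n with
  | zero =>
    rw [(Submodule.mem_bot k).1 h, LinearMap.compAlternatingMap_zero]
    exact zero_mem _
  | succ n =>
    obtain ⟨κ, rfl⟩ := h
    exact ⟨f.toLinearMap.compAlternatingMap κ, koszulD_map x f κ⟩

/-- Antisymmetrization of the values of a Hochschild cochain on a linear family `x : W → A`. -/
def antisymmetrize (n : ℕ) : HochschildCochain k A M n →ₗ[k] (W [⋀^Fin n]→ₗ[k] M) where
  toFun c := MultilinearMap.alternatization (c.compLinearMap fun _ => x)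
  map_add' c c' := by
    ext v
    simp [MultilinearMap.alternatization_apply, Finset.sum_add_distrib]
  map_smul' t c := by
    ext v
    simp [MultilinearMap.alternatization_apply, Finset.smul_sum, smul_comm _ t]

omit [Module A M] [Module Aᵐᵒᵖ M] [IsScalarTower k A M] [IsScalarTower k Aᵐᵒᵖ M] in
theorem antisymmetrize_apply {n : ℕ} (c : HochschildCochain k A M n) (v : Fin n → W) :
    antisymmetrize x n c v =
      ∑ σ : Equiv.Perm (Fin n), Equiv.Perm.sign σ • c fun i => x (v (σ i)) :=
  MultilinearMap.alternatization_apply _ _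

omit [IsScalarTower k A M] [IsScalarTower k Aᵐᵒᵖ M] [IsScalarTower k A N]
  [IsScalarTower k Aᵐᵒᵖ N] in
theorem antisymmetrize_map (f : BimoduleHom k A M N) {n : ℕ} (c : HochschildCochain k A M n) :
    antisymmetrize x n (hochschildCochainMap f n c) =
      f.toLinearMap.compAlternatingMap (antisymmetrize x n c) := by
  ext v
  simp [antisymmetrize_apply, hochschildCochainMap]

/-- Expansion of an alternating sum over permutations according to the image of `0`. -/
theorem sum_sign_smul_eq_sum_removeNth {X P : Type*} [AddCommGroup P] {n : ℕ}
    (F : (Fin (n + 1) → X) → P) (v : Fin (n + 1) → X) :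
    ∑ σ : Equiv.Perm (Fin (n + 1)), Equiv.Perm.sign σ • F (v ∘ σ) =
      ∑ i : Fin (n + 1), (-1 : ℤ) ^ (i : ℕ) • ∑ τ : Equiv.Perm (Fin n),
        Equiv.Perm.sign τ • F (Fin.cons (v i) (i.removeNth v ∘ τ)) := by
  let T : Fin (n + 1) × Equiv.Perm (Fin n) → Equiv.Perm (Fin (n + 1)) := fun p =>
    p.1.cycleRange.symm * Equiv.Perm.decomposeFin.symm (0, p.2)
  have hT0 (p) : T p 0 = p.1 := by simp [T]
  have hTs (p) (i : Fin n) : T p i.succ = p.1.succAbove (p.2 i) := by simp [T]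
  have hT : Function.Bijective T := by
    rw [Fintype.bijective_iff_injective_and_card]
    refine ⟨fun p q h => ?_, (Fintype.card_congr Equiv.Perm.decomposeFin).symm⟩
    have h1 : p.1 = q.1 := by rw [← hT0, ← hT0, h]
    refine Prod.ext h1 (Equiv.ext fun i => Fin.succAbove_right_injective (p := p.1) ?_)
    rw [← hTs, h, hTs, h1]
  rw [← (Equiv.ofBijective T hT).sum_comp, Fintype.sum_prod_type]
  refine Finset.sum_congr rfl fun i _ => ?_
  rw [Finset.smul_sum]
  refine Finset.sum_congr rfl fun τ _ => ?_
  have hv : v ∘ T (i, τ) = Fin.cons (v i) (i.removeNth v ∘ τ) := by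
    funext j
    cases j using Fin.cases with
    | zero => simp [hT0]
    | succ j => simp [hTs, Fin.removeNth]
  have hs : Equiv.Perm.sign (T (i, τ)) = (-1) ^ (i : ℕ) * Equiv.Perm.sign τ := by
    simp [T, Fin.sign_cycleRange]
  rw [Equiv.ofBijective_apply, hv, hs, mul_smul, Units.smul_def]
  simp

omit [Module Aᵐᵒᵖ M] [IsScalarTower k Aᵐᵒᵖ M] in
theorem antisymmetrize_hochschildFirst {n : ℕ} (c : HochschildCochain k A M n)
    (v : Fin (n + 1) → W) :
    antisymmetrize x (n + 1) (hochschildFirst c) v =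
      ∑ i : Fin (n + 1), (-1 : ℤ) ^ (i : ℕ) • x (v i) • antisymmetrize x n c (i.removeNth v) := by
  rw [antisymmetrize_apply]
  refine (sum_sign_smul_eq_sum_removeNth
    (fun w => hochschildFirst c fun i => x (w i)) v).trans ?_
  simp only [antisymmetrize_apply, Finset.smul_sum, hochschildFirst, MultilinearMap.mk'_apply,
    smul_comm (x _)]
  rfl

omit [Module A M] [IsScalarTower k A M] in
theorem antisymmetrize_hochschildLast {n : ℕ} (c : HochschildCochain k A M n)
    (v : Fin (n + 1) → W) :
    antisymmetrize x (n + 1) (hochschildLast c) v =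
      (-1 : ℤ) ^ n • ∑ i : Fin (n + 1), (-1 : ℤ) ^ (i : ℕ) •
        MulOpposite.op (x (v i)) • antisymmetrize x n c (i.removeNth v) := by
  let F : (Fin (n + 1) → W) → M := fun w =>
    MulOpposite.op (x (w 0)) • c fun i => x (w i.succ)
  -- the last argument is brought to the front by the rotation, of sign `(-1) ^ n`
  have h (w : Fin (n + 1) → W) :
      hochschildLast c (fun i => x (w i)) = F (w ∘ (finRotate (n + 1)).symm) := by
    obtain ⟨w, rfl⟩ : ∃ u : Fin (n + 1) → W, w = u ∘ finRotate (n + 1) :=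
      ⟨w ∘ (finRotate (n + 1)).symm, by ext; simp⟩
    simp only [hochschildLast, MultilinearMap.mk'_apply, F, Function.comp_def,
      Equiv.apply_symm_apply, finRotate_last]
    congr 3
    funext i
    change x (w (finRotate (n + 1) i.castSucc)) = _
    rw [finRotate_apply, Fin.coeSucc_eq_succ]
  have h' := sum_sign_smul_eq_sum_removeNth F v
  rw [antisymmetrize_apply, ← Equiv.sum_comp (Equiv.mulRight (finRotate (n + 1)))]
  calc
    _ = (-1 : ℤ) ^ n • ∑ σ : Equiv.Perm (Fin (n + 1)), Equiv.Perm.sign σ • F (v ∘ σ) := by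
      rw [Finset.smul_sum]
      refine Finset.sum_congr rfl fun σ _ => ?_
      have := h fun i => v ((σ * finRotate (n + 1)) i)
      rw [Equiv.coe_mulRight, this, Equiv.Perm.sign_mul, sign_finRotate, mul_comm, mul_smul,
        Units.smul_def]
      simp [Function.comp_def]
    _ = _ := by
      rw [h']
      simp only [antisymmetrize_apply, Finset.smul_sum, smul_comm (MulOpposite.op (x _)), F]
      rfl

omit [Module A M] [Module Aᵐᵒᵖ M] [IsScalarTower k A M] [IsScalarTower k Aᵐᵒᵖ M] in
theorem antisymmetrize_hochschildInner {n : ℕ} (j : Fin n) (c : HochschildCochain k A M n) :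
    antisymmetrize x (n + 1) (hochschildInner j c) = 0 := by
  ext v
  rw [antisymmetrize_apply]
  -- commutativity makes the terms of `σ` and `σ * (j j+1)` cancel
  have hne : j.castSucc ≠ j.succ := (Fin.castSucc_lt_succ).ne
  refine Finset.sum_involution (fun σ _ => σ * Equiv.swap j.castSucc j.succ)
    (fun σ _ => ?_) (fun σ _ _ => ?_) (fun σ _ => Finset.mem_univ _) (fun σ _ => ?_)
  · have : (hochschildInner j c fun i => x (v ((σ * Equiv.swap j.castSucc j.succ) i))) =
        hochschildInner j c fun i => x (v (σ i)) := by
      change c _ = c _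
      congr 1
      funext i
      rcases Nat.lt_trichotomy (i : ℕ) j with h | h | h
      · rw [Fin.contractNth_apply_of_lt _ _ _ _ (by simpa),
          Fin.contractNth_apply_of_lt _ _ _ _ (by simpa), Equiv.Perm.mul_apply,
          Equiv.swap_apply_of_ne_of_ne] <;> simp [Fin.ext_iff] <;> omega
      · obtain rfl : i = j := Fin.ext h
        rw [Fin.contractNth_apply_of_eq _ _ _ _ (by simp),
          Fin.contractNth_apply_of_eq _ _ _ _ (by simp), Equiv.Perm.mul_apply,
          Equiv.Perm.mul_apply, Equiv.swap_apply_left, Equiv.swap_apply_right, mul_comm]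
      · rw [Fin.contractNth_apply_of_gt _ _ _ _ (by simpa),
          Fin.contractNth_apply_of_gt _ _ _ _ (by simpa), Equiv.Perm.mul_apply,
          Equiv.swap_apply_of_ne_of_ne] <;> simp [Fin.ext_iff] <;> omega
    rw [this, Equiv.Perm.sign_mul, Equiv.Perm.sign_swap hne, mul_neg_one, Units.neg_smul,
      add_neg_cancel]
  · exact fun h => hne (Equiv.swap_eq_one_iff.1 (mul_eq_left.1 h))
  · simp [mul_assoc]

/-- Antisymmetrization is a morphism from the Hochschild complex to the Koszul complex. -/
theorem antisymmetrize_hochschildD {n : ℕ} (c : HochschildCochain k A M n) :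
    antisymmetrize x (n + 1) (hochschildD k A M n c) = koszulD x M n (antisymmetrize x n c) := by
  have h : antisymmetrize x (n + 1) (∑ j : Fin n, (-1 : k) ^ ((j : ℕ) + 1) • hochschildInner j c)
      = 0 := by
    rw [map_sum]
    exact Finset.sum_eq_zero fun j _ => by
      rw [map_smul, antisymmetrize_hochschildInner, smul_zero]
  rw [hochschildD_eq, hochschildLeftD, map_add, map_add, h, add_zero, map_smul]
  ext v
  rw [AlternatingMap.add_apply, AlternatingMap.smul_apply, antisymmetrize_hochschildFirst,
    antisymmetrize_hochschildLast, koszulD_apply]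
  simp only [commutatorMap_apply, smul_sub, Finset.sum_sub_distrib]
  rw [sub_eq_add_neg]
  congr 1
  rw [← Int.cast_smul_eq_zsmul k ((-1) ^ n), smul_smul]
  push_cast
  rw [← pow_add, show n + 1 + n = 2 * n + 1 by ring, pow_succ, pow_mul]
  simp

theorem antisymmetrize_mem_koszulCoboundaries {n : ℕ} {c : HochschildCochain k A M n}
    (h : c ∈ hochschildCoboundaries k A M n) :
    antisymmetrize x n c ∈ koszulCoboundaries x M n := by
  cases n with
  | zero =>
    rw [(Submodule.mem_bot k).1 h, map_zero]
    exact zero_mem _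
  | succ n =>
    obtain ⟨c, rfl⟩ := h
    exact ⟨antisymmetrize x n c, (antisymmetrize_hochschildD x c).symm⟩

end Koszul

/-! ### Comparison of Hochschild and Koszul cohomology by dimension shifting -/

section QuotientBimodule

variable {k : Type*} [CommRing k] {E : Type*} [AddCommGroup E] [Module k E]

/-- The action of a `k`-algebra `B` on the quotient of a `B`-module by a `B`-stable
`k`-submodule. -/
abbrev Submodule.quotientModuleOfStable {B : Type*} [Ring B] [Algebra k B] [Module B E]
    [IsScalarTower k B E] (S : Submodule k E) (h : ∀ (b : B), ∀ e ∈ S, b • e ∈ S) :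
    Module B (E ⧸ S) where
  smul b := S.mapQ S (Algebra.lsmul k k E b) (h b)
  one_smul := by rintro ⟨e⟩; exact congrArg S.mkQ (one_smul B e)
  mul_smul b b' := by rintro ⟨e⟩; exact congrArg S.mkQ (mul_smul b b' e)
  smul_zero b := map_zero _
  smul_add b := map_add _
  add_smul b b' := by rintro ⟨e⟩; exact congrArg S.mkQ (add_smul b b' e)
  zero_smul := by rintro ⟨e⟩; exact congrArg S.mkQ (zero_smul B e)

variable (k) (A : Type*) [Ring A] [Algebra k A]
variable (M : Type*) [AddCommGroup M] [Module k M] [Module A M] [Module Aᵐᵒᵖ M]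
  [IsScalarTower k A M] [IsScalarTower k Aᵐᵒᵖ M] [SMulCommClass A Aᵐᵒᵖ M]

/-- The quotient of the coinduced bimodule `Hom_k(A, M)` by `M`. -/
def CoinducedQuotient : Type _ :=
  CoinducedBimodule k A M ⧸ LinearMap.range (toCoinduced (k := k) (A := A) (M := M)).toLinearMap

namespace CoinducedQuotient

instance : AddCommGroup (CoinducedQuotient k A M) :=
  inferInstanceAs (AddCommGroup (_ ⧸ LinearMap.range _))

instance : Module k (CoinducedQuotient k A M) := inferInstanceAs (Module k (_ ⧸ LinearMap.range _))

instance : Module A (CoinducedQuotient k A M) :=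
  Submodule.quotientModuleOfStable _ <| by
    rintro a _ ⟨m, rfl⟩
    exact ⟨a • m, toCoinduced.map_left a m⟩

instance : Module Aᵐᵒᵖ (CoinducedQuotient k A M) :=
  Submodule.quotientModuleOfStable _ <| by
    rintro a _ ⟨m, rfl⟩
    exact ⟨a • m, toCoinduced.map_right a.unop m⟩

/-- The projection `Hom_k(A, M) → Hom_k(A, M) / M`. -/
def mk : BimoduleHom k A (CoinducedBimodule k A M) (CoinducedQuotient k A M) where
  toLinearMap := Submodule.mkQ _
  map_left _ _ := rfl
  map_right _ _ := rfl

theorem mk_surjective : Function.Surjective (mk k A M).toLinearMap := Submodule.mkQ_surjective _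

instance : IsScalarTower k A (CoinducedQuotient k A M) where
  smul_assoc t a q := by
    obtain ⟨e, rfl⟩ := mk_surjective k A M q
    rw [← (mk k A M).map_left, ← (mk k A M).map_left, ← map_smul, smul_assoc]

instance : IsScalarTower k Aᵐᵒᵖ (CoinducedQuotient k A M) where
  smul_assoc t a q := by
    obtain ⟨e, rfl⟩ := mk_surjective k A M q
    exact congrArg (mk k A M).toLinearMap (smul_assoc t a e)

instance : SMulCommClass A Aᵐᵒᵖ (CoinducedQuotient k A M) where
  smul_comm a b q := by
    obtain ⟨e, rfl⟩ := mk_surjective k A M q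
    exact congrArg (mk k A M).toLinearMap (smul_comm a b e)

theorem exact_toCoinduced_mk : Function.Exact (toCoinduced (k := k) (A := A) (M := M)).toLinearMap
    (mk k A M).toLinearMap := LinearMap.exact_map_mkQ_range _

end CoinducedQuotient

end QuotientBimodule

section Comparison

universe u

variable {k : Type*} [Field k] {A : Type u} [CommRing A] [Algebra k A]
variable {W : Type*} [AddCommGroup W] [Module k W] (x : W →ₗ[k] A)

section ExactSequence

variable {M : Type*} [AddCommGroup M] [Module k M] [Module A M] [Module Aᵐᵒᵖ M]
variable {N : Type u} [AddCommGroup N] [Module k N] [Module A N] [Module Aᵐᵒᵖ N]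
variable {P : Type*} [AddCommGroup P] [Module k P] [Module A P] [Module Aᵐᵒᵖ P]

theorem exists_hochschildCochainMap_eq (g : BimoduleHom k A N P)
    (hg : Function.Surjective g.toLinearMap) {n : ℕ} (c : HochschildCochain k A P n) :
    ∃ c', hochschildCochainMap g n c' = c := by
  obtain ⟨s, hs⟩ := g.toLinearMap.exists_rightInverse_of_surjective (LinearMap.range_eq_top.2 hg)
  refine ⟨s.compMultilinearMap c, ?_⟩
  ext a
  exact LinearMap.congr_fun hs (c a)

theorem hochschildCochainMap_injective (f : BimoduleHom k A M N)
    (hf : Function.Injective f.toLinearMap) (n : ℕ) :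
    Function.Injective (hochschildCochainMap f n) := fun c c' h => by
  ext a
  exact hf (DFunLike.congr_fun h a)

theorem exists_hochschildCochainMap_eq_of_exact (f : BimoduleHom k A M N) (g : BimoduleHom k A N P)
    (hf : Function.Injective f.toLinearMap) (hfg : Function.Exact f.toLinearMap g.toLinearMap)
    {n : ℕ} (c : HochschildCochain k A N n) (hc : hochschildCochainMap g n c = 0) :
    ∃ c', hochschildCochainMap f n c' = c := by
  obtain ⟨r, hr⟩ := f.toLinearMap.exists_leftInverse_of_injective (LinearMap.ker_eq_bot.2 hf)
  refine ⟨r.compMultilinearMap c, ?_⟩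
  ext a
  obtain ⟨m, hm⟩ := (hfg (c a)).1 (DFunLike.congr_fun hc a)
  change f.toLinearMap (r (c a)) = c a
  rw [← hm, ← LinearMap.comp_apply r, hr, LinearMap.id_apply]

theorem exists_compAlternatingMap_eq {ι : Type*} (g : N →ₗ[k] P) (hg : Function.Surjective g)
    (κ : W [⋀^ι]→ₗ[k] P) : ∃ κ', g.compAlternatingMap κ' = κ := by
  obtain ⟨s, hs⟩ := g.exists_rightInverse_of_surjective (LinearMap.range_eq_top.2 hg)
  refine ⟨s.compAlternatingMap κ, ?_⟩
  ext a
  exact LinearMap.congr_fun hs (κ a)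

theorem compAlternatingMap_injective {ι : Type*} (f : M →ₗ[k] N) (hf : Function.Injective f) :
    Function.Injective (f.compAlternatingMap : (W [⋀^ι]→ₗ[k] M) → W [⋀^ι]→ₗ[k] N) :=
  fun κ κ' h => by
    ext v
    exact hf (DFunLike.congr_fun h v)

theorem exists_compAlternatingMap_eq_of_exact {ι : Type*} (f : M →ₗ[k] N) (g : N →ₗ[k] P)
    (hf : Function.Injective f) (hfg : Function.Exact f g) (κ : W [⋀^ι]→ₗ[k] N)
    (hκ : g.compAlternatingMap κ = 0) : ∃ κ', f.compAlternatingMap κ' = κ := by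
  obtain ⟨r, hr⟩ := f.exists_leftInverse_of_injective (LinearMap.ker_eq_bot.2 hf)
  refine ⟨r.compAlternatingMap κ, ?_⟩
  ext v
  obtain ⟨m, hm⟩ := (hfg (κ v)).1 (DFunLike.congr_fun hκ v)
  change f (r (κ v)) = κ v
  rw [← hm, ← LinearMap.comp_apply r, hr, LinearMap.id_apply]

variable [IsScalarTower k A M] [IsScalarTower k Aᵐᵒᵖ M] [IsScalarTower k A N]
  [IsScalarTower k Aᵐᵒᵖ N] [IsScalarTower k A P] [IsScalarTower k Aᵐᵒᵖ P]

theorem hochschildD_eq_zero_of_mem_coboundaries [SMulCommClass A Aᵐᵒᵖ N] {n : ℕ}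
    {c : HochschildCochain k A N n} (h : c ∈ hochschildCoboundaries k A N n) :
    hochschildD k A N n c = 0 := by
  cases n with
  | zero => rw [(Submodule.mem_bot k).1 h, map_zero]
  | succ n => obtain ⟨c, rfl⟩ := h; exact hochschildD_comp_hochschildD n c

theorem exists_mem_hochschildCoboundaries_map_eq (g : BimoduleHom k A N P)
    (hg : Function.Surjective g.toLinearMap) {n : ℕ} {c : HochschildCochain k A P n}
    (hc : c ∈ hochschildCoboundaries k A P n) :
    ∃ b ∈ hochschildCoboundaries k A N n, hochschildCochainMap g n b = c := by
  cases n with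
  | zero => exact ⟨0, zero_mem _, by rw [map_zero, (Submodule.mem_bot k).1 hc]⟩
  | succ n =>
    obtain ⟨b, rfl⟩ := hc
    obtain ⟨b, rfl⟩ := exists_hochschildCochainMap_eq g hg b
    exact ⟨_, ⟨b, rfl⟩, (hochschildD_map g n b).symm⟩

theorem exists_mem_koszulCoboundaries_map_eq (g : BimoduleHom k A N P)
    (hg : Function.Surjective g.toLinearMap) {n : ℕ} {κ : W [⋀^Fin n]→ₗ[k] P}
    (hκ : κ ∈ koszulCoboundaries x P n) :
    ∃ b ∈ koszulCoboundaries x N n, g.toLinearMap.compAlternatingMap b = κ := by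
  cases n with
  | zero => exact ⟨0, zero_mem _, by rw [(Submodule.mem_bot k).1 hκ]; ext; simp⟩
  | succ n =>
    obtain ⟨b, rfl⟩ := hκ
    obtain ⟨b, rfl⟩ := exists_compAlternatingMap_eq g.toLinearMap hg b
    exact ⟨_, ⟨b, rfl⟩, (koszulD_map x g b).symm⟩

variable (M) in
/-- Antisymmetrization induces a bijection from the Hochschild to the Koszul cohomology with
coefficients in `M` in degree `n`. -/
structure AntisymmetrizeBijective (n : ℕ) : Prop where
  inj : ∀ c : HochschildCochain k A M n, hochschildD k A M n c = 0 →
    antisymmetrize x n c ∈ koszulCoboundaries x M n → c ∈ hochschildCoboundaries k A M n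
  surj : ∀ κ : W [⋀^Fin n]→ₗ[k] M, koszulD x M n κ = 0 → ∃ c : HochschildCochain k A M n,
    hochschildD k A M n c = 0 ∧ antisymmetrize x n c - κ ∈ koszulCoboundaries x M n

/-- In degree zero both cohomologies are the centre of the bimodule, as soon as the linear family
`x` generates the algebra. -/
theorem antisymmetrizeBijective_zero [SMulCommClass A Aᵐᵒᵖ M]
    (hx : Algebra.adjoin k (Set.range x) = ⊤) : AntisymmetrizeBijective x M 0 where
  inj c _ h := by
    have h' := DFunLike.congr_fun ((Submodule.mem_bot k).1 h) ![]
    rw [antisymmetrize_apply] at h'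
    refine (Submodule.mem_bot k).2 (MultilinearMap.ext fun a => ?_)
    rw [Subsingleton.elim a fun i => x (![] i)]
    simpa using h'
  surj κ hκ := by
    have hcomm (w : W) : x w • κ ![] = MulOpposite.op (x w) • κ ![] := by
      have := DFunLike.congr_fun hκ ![w]
      rw [koszulD_apply] at this
      simpa [commutatorMap_apply, sub_eq_zero,
        Subsingleton.elim (Fin.removeNth 0 ![w]) ![]] using this
    have hall (a : A) : a • κ ![] = MulOpposite.op a • κ ![] := by
      have ha : a ∈ Algebra.adjoin k (Set.range x) := hx ▸ Algebra.mem_top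
      induction ha using Algebra.adjoin_induction with
      | mem a ha => obtain ⟨w, rfl⟩ := ha; exact hcomm w
      | algebraMap t =>
        rw [algebraMap_smul, ← MulOpposite.algebraMap_apply, algebraMap_smul]
      | add a b _ _ ha hb => rw [add_smul, MulOpposite.op_add, add_smul, ha, hb]
      | mul a b _ _ ha hb =>
        rw [mul_smul, hb, smul_comm, ha, mul_comm, MulOpposite.op_mul, ← mul_smul, mul_comm]
    refine ⟨MultilinearMap.constOfIsEmpty k _ (κ ![]), ?_, ?_⟩
    · ext a
      simp [hochschildD, hochschildFirst, hochschildLast, hall]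
    · have : antisymmetrize x 0 (MultilinearMap.constOfIsEmpty k (fun _ => A) (κ ![])) = κ := by
        ext v
        rw [antisymmetrize_apply]
        simp [Subsingleton.elim v ![]]
      rw [this, sub_self]
      exact zero_mem _

/-- Dimension shifting along a short exact sequence of bimodules whose middle term is acyclic
in degree `n + 1`. -/
theorem AntisymmetrizeBijective.succ [SMulCommClass A Aᵐᵒᵖ N]
    (f : BimoduleHom k A M N) (g : BimoduleHom k A N P)
    (hf : Function.Injective f.toLinearMap) (hg : Function.Surjective g.toLinearMap)
    (hfg : Function.Exact f.toLinearMap g.toLinearMap) {n : ℕ}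
    (hN : ∀ c : HochschildCochain k A N (n + 1), hochschildD k A N (n + 1) c = 0 →
      ∃ b, hochschildD k A N n b = c)
    (hN' : ∀ κ : W [⋀^Fin (n + 1)]→ₗ[k] N, koszulD x N (n + 1) κ = 0 →
      ∃ b, koszulD x N n b = κ)
    (h : AntisymmetrizeBijective x N n) (hP : AntisymmetrizeBijective x P n) :
    AntisymmetrizeBijective x M (n + 1) where
  inj c hc hc' := by
    obtain ⟨κ, hκ⟩ := hc'
    obtain ⟨e, he⟩ := hN (hochschildCochainMap f (n + 1) c) (by rw [hochschildD_map, hc, map_zero])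
    -- a cocycle is subtracted from `e` so that its antisymmetrization comes from `M`
    obtain ⟨z, hz, hz'⟩ := h.surj (antisymmetrize x n e - f.toLinearMap.compAlternatingMap κ) (by
      rw [map_sub, ← antisymmetrize_hochschildD, he, koszulD_map, hκ, antisymmetrize_map, sub_self])
    have hgf : g.toLinearMap.compAlternatingMap (f.toLinearMap.compAlternatingMap κ) = 0 := by
      ext v
      exact hfg.apply_apply_eq_zero (κ v)
    obtain ⟨b, hb, hb'⟩ := exists_mem_hochschildCoboundaries_map_eq g hg
      (hP.inj (hochschildCochainMap g n (z - e)) (by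
        have hgf' : hochschildCochainMap g (n + 1) (hochschildCochainMap f (n + 1) c) = 0 := by
          ext a
          exact hfg.apply_apply_eq_zero (c a)
        rw [hochschildD_map, map_sub, hz, he, zero_sub, map_neg, hgf', neg_zero]) (by
        rw [antisymmetrize_map]
        have := map_mem_koszulCoboundaries x g hz'
        rw [← sub_add, ← map_sub] at this
        rwa [LinearMap.compAlternatingMap_add, hgf, add_zero] at this))
    obtain ⟨m, hm⟩ := exists_hochschildCochainMap_eq_of_exact f g hf hfg (z - e - b)
      (by rw [map_sub, hb', sub_self])
    refine ⟨-m, hochschildCochainMap_injective f hf _ ?_⟩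
    rw [← hochschildD_map, map_neg, hm, map_neg, map_sub, map_sub, hz, he,
      hochschildD_eq_zero_of_mem_coboundaries hb]
    simp
  surj κ hκ := by
    obtain ⟨l, hl⟩ := hN' (f.toLinearMap.compAlternatingMap κ) (by
      rw [koszulD_map, hκ, LinearMap.compAlternatingMap_zero])
    obtain ⟨q, hq, hq'⟩ := hP.surj (g.toLinearMap.compAlternatingMap l) (by
      rw [koszulD_map, hl]
      ext v
      exact hfg.apply_apply_eq_zero (κ v))
    obtain ⟨e, rfl⟩ := exists_hochschildCochainMap_eq g hg q
    rw [hochschildD_map] at hq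
    obtain ⟨c, hc⟩ := exists_hochschildCochainMap_eq_of_exact f g hf hfg _ hq
    obtain ⟨b, hb, hb'⟩ := exists_mem_koszulCoboundaries_map_eq x g hg hq'
    obtain ⟨ν, hν⟩ := exists_compAlternatingMap_eq_of_exact f.toLinearMap g.toLinearMap hf hfg
      (antisymmetrize x n e - l - b) (by
        ext v
        have := DFunLike.congr_fun hb' v
        rw [antisymmetrize_map] at this
        simp only [LinearMap.compAlternatingMap_apply, AlternatingMap.sub_apply, map_sub,
          AlternatingMap.zero_apply] at this ⊢
        rw [this, sub_self])
    refine ⟨c, hochschildCochainMap_injective f hf _ ?_, ν, ?_⟩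
    · rw [← hochschildD_map, hc, hochschildD_comp_hochschildD, map_zero]
    · apply compAlternatingMap_injective f.toLinearMap hf
      rw [← koszulD_map, hν, map_sub, map_sub, koszulD_eq_zero_of_mem_coboundaries x hb, hl,
        ← antisymmetrize_hochschildD, ← hc, antisymmetrize_map, sub_zero]
      ext v
      simp

end ExactSequence

/-- If the coinduced bimodules are acyclic for the Koszul complex, then antisymmetrization is a
quasi-isomorphism for all coefficient bimodules. -/
theorem antisymmetrizeBijective_of_coinduced (hx : Algebra.adjoin k (Set.range x) = ⊤)
    (H : ∀ (M : Type u) [AddCommGroup M] [Module k M] [Module A M] [IsScalarTower k A M] (n : ℕ)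
      (κ : W [⋀^Fin (n + 1)]→ₗ[k] CoinducedBimodule k A M), koszulD x _ (n + 1) κ = 0 →
      ∃ b, koszulD x (CoinducedBimodule k A M) n b = κ) (n : ℕ) :
    ∀ (M : Type u) [AddCommGroup M] [Module k M] [Module A M] [Module Aᵐᵒᵖ M] [IsScalarTower k A M]
      [IsScalarTower k Aᵐᵒᵖ M] [SMulCommClass A Aᵐᵒᵖ M], AntisymmetrizeBijective x M n := by
  induction n with
  | zero => intros; exact antisymmetrizeBijective_zero x hx
  | succ n ih =>
    intro M _ _ _ _ _ _ _
    exact .succ x toCoinduced (CoinducedQuotient.mk k A M) toCoinduced_injective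
      (CoinducedQuotient.mk_surjective k A M) (CoinducedQuotient.exact_toCoinduced_mk k A M)
      (exists_hochschildD_eq_of_coinduced) (H M n) (ih _) (ih _)

end Comparison

/-! ### Contracting homotopies of Koszul complexes -/

section KoszulHomotopy

variable {k : Type*} [CommRing k] {A : Type*} [CommRing A] [Algebra k A]
variable {W : Type*} [AddCommGroup W] [Module k W] (x : W →ₗ[k] A)
variable {M : Type*} [AddCommGroup M] [Module k M] [Module A M] [Module Aᵐᵒᵖ M]
  [IsScalarTower k A M] [IsScalarTower k Aᵐᵒᵖ M]
variable {ι : Type*} (b : Module.Basis ι k W)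

/-- The contraction with the basis vector `b j`, followed by a map `s` commuting with the
commutators of the other basis vectors, is a homotopy. On a tuple of distinct basis vectors it
relates the identity to `1 - s D_j` or to `1 - D_j s`, where `D_j` is the commutator with
`x (b j)`, according to whether `b j` is absent from the tuple or not. -/
theorem exists_koszul_homotopic (j : ι) (s : M →ₗ[k] M)
    (hs : ∀ l ≠ j, ∀ m, commutatorMap x M (b l) (s m) = s (commutatorMap x M (b l) m)) {n : ℕ}
    (κ : W [⋀^Fin n]→ₗ[k] M) (hκ : koszulD x M n κ = 0) :
    ∃ κ' : W [⋀^Fin n]→ₗ[k] M, κ - κ' ∈ koszulCoboundaries x M n ∧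
      ∀ v : Fin n → ι, Function.Injective v →
        (j ∈ Set.range v → κ' (b ∘ v) = κ (b ∘ v) - commutatorMap x M (b j) (s (κ (b ∘ v)))) ∧
        (j ∉ Set.range v → κ' (b ∘ v) = κ (b ∘ v) - s (commutatorMap x M (b j) (κ (b ∘ v)))) := by
  cases n with
  | zero =>
    refine ⟨κ, by rw [sub_self]; exact zero_mem _, fun v _ => ⟨fun h => h.elim finZeroElim, ?_⟩⟩
    intro _
    have h := DFunLike.congr_fun hκ ![b j]
    rw [koszulD_apply, Fin.sum_univ_succ] at h
    simp only [Finset.univ_eq_empty, Finset.sum_empty, add_zero, Fin.val_zero, pow_zero, one_smul,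
      AlternatingMap.zero_apply,
      Matrix.cons_val_zero] at h
    rw [Subsingleton.elim (b ∘ v) (Fin.removeNth 0 ![b j]), h, map_zero, sub_zero]
  | succ n =>
    let η : W [⋀^Fin n]→ₗ[k] M := s.compAlternatingMap (κ.curryLeft (b j))
    refine ⟨κ - koszulD x M n η, ⟨η, by simp⟩, fun v hv => ?_⟩
    -- the cocycle condition on the tuple `b j, b (v 0), …, b (v n)`
    have h1 : s (commutatorMap x M (b j) (κ (b ∘ v))) = ∑ i : Fin (n + 1), (-1 : ℤ) ^ (i : ℕ) •
        s (commutatorMap x M (b (v i)) (κ (Matrix.vecCons (b j) (i.removeNth (b ∘ v))))) := by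
      have h := DFunLike.congr_fun hκ (Matrix.vecCons (b j) (b ∘ v))
      rw [koszulD_apply, Fin.sum_univ_succ, AlternatingMap.zero_apply] at h
      simp only [Fin.val_zero, pow_zero, one_smul, Matrix.cons_val_zero, Fin.val_succ, pow_succ,
        mul_neg_one, neg_smul, Matrix.cons_val_succ, Finset.sum_neg_distrib] at h
      have h0 : Fin.removeNth 0 (Matrix.vecCons (b j) (b ∘ v)) = b ∘ v := rfl
      have h' (i : Fin (n + 1)) : Fin.removeNth i.succ (Matrix.vecCons (b j) (b ∘ v)) =
          Matrix.vecCons (b j) (i.removeNth (b ∘ v)) := by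
        funext l
        cases l using Fin.cases with
        | zero => rfl
        | succ l => simp [Fin.removeNth]
      simp only [h0, h', add_neg_eq_zero] at h
      rw [h, map_sum]
      simp only [map_zsmul, Function.comp_apply]
    have h2 : koszulD x M n η (b ∘ v) = ∑ i : Fin (n + 1), (-1 : ℤ) ^ (i : ℕ) •
        commutatorMap x M (b (v i)) (s (κ (Matrix.vecCons (b j) (i.removeNth (b ∘ v))))) :=
      koszulD_apply x η _
    rw [AlternatingMap.sub_apply]
    constructor
    · rintro ⟨i, rfl⟩
      have h3 : (-1 : ℤ) ^ (i : ℕ) • κ (Matrix.vecCons (b (v i)) (i.removeNth (b ∘ v))) =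
          κ (b ∘ v) := by
        rw [← AlternatingMap.map_insertNth]
        exact congrArg κ (Fin.insertNth_self_removeNth i (b ∘ v))
      have h4 : koszulD x M n η (b ∘ v) - s (commutatorMap x M (b (v i)) (κ (b ∘ v))) =
          commutatorMap x M (b (v i)) (s (κ (b ∘ v))) -
            s (commutatorMap x M (b (v i)) (κ (b ∘ v))) := by
        rw [h2]
        conv_lhs => rw [h1]
        rw [← Finset.sum_sub_distrib, Finset.sum_eq_single i]
        · rw [← h3]
          simp only [map_zsmul]
        · intro l _ hl
          rw [hs _ (hv.ne hl), sub_self]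
        · simp
      rw [sub_left_inj.1 h4]
    · intro hj
      rw [h2, h1]
      congr 1
      exact Finset.sum_congr rfl fun i _ => by rw [hs _ fun h => hj ⟨i, h⟩]

/-- If every commutator `D_j` has a right inverse that commutes with the other commutators, then
the Koszul complex is acyclic in positive degrees. -/
theorem exists_koszulD_eq_of_rightInverse [SMulCommClass A Aᵐᵒᵖ M] [Finite ι] (s : ι → M →ₗ[k] M)
    (hs : ∀ j m, commutatorMap x M (b j) (s j m) = m)
    (hs' : ∀ j, ∀ l ≠ j, ∀ m,
      commutatorMap x M (b l) (s j m) = s j (commutatorMap x M (b l) m)) {n : ℕ}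
    (κ : W [⋀^Fin (n + 1)]→ₗ[k] M) (hκ : koszulD x M (n + 1) κ = 0) :
    ∃ η, koszulD x M n η = κ := by
  classical
  have := Fintype.ofFinite ι
  have key (S : Finset ι) : ∃ κ' : W [⋀^Fin (n + 1)]→ₗ[k] M, koszulD x M (n + 1) κ' = 0 ∧
      κ - κ' ∈ koszulCoboundaries x M (n + 1) ∧ ∀ v : Fin (n + 1) → ι, Function.Injective v →
        ∀ j ∈ S, j ∈ Set.range v → κ' (b ∘ v) = 0 := by
    induction S using Finset.induction_on with
    | empty => exact ⟨κ, hκ, by rw [sub_self]; exact zero_mem _, by simp⟩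
    | insert j S _ ih =>
      obtain ⟨κ₁, h₁, h₂, h₃⟩ := ih
      obtain ⟨κ₂, h₄, h₅⟩ := exists_koszul_homotopic x b j (s j) (hs' j) κ₁ h₁
      have h₆ := koszulD_eq_zero_of_mem_coboundaries x h₄
      rw [map_sub, h₁, zero_sub, neg_eq_zero] at h₆
      refine ⟨κ₂, h₆, by simpa using add_mem h₂ h₄, fun v hv l hl hlv => ?_⟩
      by_cases hj : j ∈ Set.range v
      · rw [(h₅ v hv).1 hj, hs, sub_self]
      · have hl' : l ∈ S := (Finset.mem_insert.1 hl).resolve_left fun h => hj (h ▸ hlv)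
        rw [(h₅ v hv).2 hj, h₃ v hv l hl' hlv]
        simp
  obtain ⟨κ', _, ⟨η, h⟩, h'⟩ := key Finset.univ
  refine ⟨η, ?_⟩
  have : κ' = 0 := b.ext_alternating fun v hv =>
    h' v hv (v 0) (Finset.mem_univ _) (Set.mem_range_self 0)
  rw [h, this, sub_zero]

/-- If the commutators `D_j`, `j ∈ S`, have commuting left inverses `s_j` that commute with the
other commutators, then every Koszul cocycle is cohomologous to one whose values on tuples of
distinct basis vectors are killed by all `s_j`, and vanish unless the tuple contains all `b j`
with `j ∈ S`. -/
theorem exists_koszul_homologous_of_leftInverse [SMulCommClass A Aᵐᵒᵖ M] (S : Finset ι)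
    (s : ι → M →ₗ[k] M) (hs : ∀ j ∈ S, ∀ m, s j (commutatorMap x M (b j) m) = m)
    (hs' : ∀ j ∈ S, ∀ l ≠ j, ∀ m,
      commutatorMap x M (b l) (s j m) = s j (commutatorMap x M (b l) m))
    (hss : ∀ i j m, s i (s j m) = s j (s i m)) {n : ℕ}
    (κ : W [⋀^Fin n]→ₗ[k] M) (hκ : koszulD x M n κ = 0) :
    ∃ κ' : W [⋀^Fin n]→ₗ[k] M, κ - κ' ∈ koszulCoboundaries x M n ∧
      ∀ v : Fin n → ι, Function.Injective v → ∀ j ∈ S,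
        s j (κ' (b ∘ v)) = 0 ∧ (j ∉ Set.range v → κ' (b ∘ v) = 0) := by
  classical
  suffices h : ∀ T ⊆ S, ∃ κ' : W [⋀^Fin n]→ₗ[k] M, koszulD x M n κ' = 0 ∧
      κ - κ' ∈ koszulCoboundaries x M n ∧ ∀ v : Fin n → ι, Function.Injective v → ∀ j ∈ T,
        s j (κ' (b ∘ v)) = 0 ∧ (j ∉ Set.range v → κ' (b ∘ v) = 0) by
    obtain ⟨κ', -, h⟩ := h S subset_rfl
    exact ⟨κ', h⟩
  intro T hT
  induction T using Finset.induction_on with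
  | empty => exact ⟨κ, hκ, by rw [sub_self]; exact zero_mem _, by simp⟩
  | insert j T hjT ih =>
    rw [Finset.insert_subset_iff] at hT
    obtain ⟨κ₁, h₁, h₂, h₃⟩ := ih hT.2
    obtain ⟨κ₂, h₄, h₅⟩ := exists_koszul_homotopic x b j (s j) (hs' j hT.1) κ₁ h₁
    have h₆ := koszulD_eq_zero_of_mem_coboundaries x h₄
    rw [map_sub, h₁, zero_sub, neg_eq_zero] at h₆
    refine ⟨κ₂, h₆, by simpa using add_mem h₂ h₄, fun v hv l hl => ?_⟩
    by_cases hj : j ∈ Set.range v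
    · rw [(h₅ v hv).1 hj]
      rcases Finset.mem_insert.1 hl with rfl | hl
      · exact ⟨by rw [map_sub, hs l hT.1, sub_self], fun h => absurd hj h⟩
      · have hne : j ≠ l := fun h => hjT (h ▸ hl)
        obtain ⟨h₇, h₈⟩ := h₃ v hv l hl
        refine ⟨?_, fun h => by rw [h₈ h]; simp⟩
        rw [map_sub, h₇, ← hs' l (hT.2 hl) j hne, hss, h₇]
        simp
    · rw [(h₅ v hv).2 hj, hs j hT.1, sub_self]
      simp

end KoszulHomotopy

/-! ### Division by a coordinate in a symmetric algebra -/

section CoordDiv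

open MvPolynomial

/-- Division of polynomials by a variable, dropping the monomials not divisible by it. -/
noncomputable def MvPolynomial.divX {k ι : Type*} [CommSemiring k] (j : ι) :
    MvPolynomial ι k →ₗ[k] MvPolynomial ι k where
  toFun p := p.divMonomial (Finsupp.single j 1)
  map_add' p q := add_divMonomial p q _
  map_smul' t p := by ext; simp [coeff_divMonomial]

theorem MvPolynomial.coeff_divX {k ι : Type*} [CommSemiring k] (j : ι) (p : MvPolynomial ι k)
    (m : ι →₀ ℕ) : (divX j p).coeff m = p.coeff (Finsupp.single j 1 + m) :=
  coeff_divMonomial _ _ _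

variable {k : Type*} [CommRing k] {W : Type*} [AddCommGroup W] [Module k W]
variable {ι : Type*} (b : Module.Basis ι k W)

/-- Division by the coordinate `b j` in the symmetric algebra, dropping the monomials in the basis
`b` that are not divisible by `b j`. -/
noncomputable def coordDiv (j : ι) : SymmetricAlgebra k W →ₗ[k] SymmetricAlgebra k W :=
  (SymmetricAlgebra.equivMvPolynomial b).symm.toLinearMap ∘ₗ divX j ∘ₗ
    (SymmetricAlgebra.equivMvPolynomial b).toLinearMap

theorem equivMvPolynomial_coordDiv (j : ι) (a : SymmetricAlgebra k W) :
    SymmetricAlgebra.equivMvPolynomial b (coordDiv b j a) =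
      divX j (SymmetricAlgebra.equivMvPolynomial b a) := by
  simp [coordDiv]

theorem coordDiv_mul_self (j : ι) (a : SymmetricAlgebra k W) :
    coordDiv b j (SymmetricAlgebra.ι k W (b j) * a) = a := by
  apply (SymmetricAlgebra.equivMvPolynomial b).injective
  rw [equivMvPolynomial_coordDiv, map_mul, SymmetricAlgebra.equivMvPolynomial_ι_apply]
  exact X_mul_divMonomial _ _

theorem coordDiv_mul_of_ne {j l : ι} (h : l ≠ j) (a : SymmetricAlgebra k W) :
    coordDiv b j (SymmetricAlgebra.ι k W (b l) * a) =
      SymmetricAlgebra.ι k W (b l) * coordDiv b j a := by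
  classical
  apply (SymmetricAlgebra.equivMvPolynomial b).injective
  ext m
  have hmul := map_mul (SymmetricAlgebra.equivMvPolynomial b) (SymmetricAlgebra.ι k W (b l))
  rw [equivMvPolynomial_coordDiv, hmul, hmul, SymmetricAlgebra.equivMvPolynomial_ι_apply,
    equivMvPolynomial_coordDiv, coeff_divX, coeff_X_mul', coeff_X_mul', coeff_divX]
  have h1 : l ∈ (Finsupp.single j 1 + m).support ↔ l ∈ m.support := by
    simp [Finsupp.single_eq_of_ne h]
  by_cases h2 : l ∈ m.support
  · rw [if_pos (h1.2 h2), if_pos h2, add_tsub_assoc_of_le]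
    simpa [Nat.one_le_iff_ne_zero] using h2
  · rw [if_neg (h1.not.2 h2), if_neg h2]

theorem coordDiv_comm (i j : ι) (a : SymmetricAlgebra k W) :
    coordDiv b i (coordDiv b j a) = coordDiv b j (coordDiv b i a) := by
  apply (SymmetricAlgebra.equivMvPolynomial b).injective
  ext m
  simp only [equivMvPolynomial_coordDiv, coeff_divX, add_left_comm]

theorem exists_coordDiv_pow_eq_zero (j : ι) (a : SymmetricAlgebra k W) :
    ∃ n, ∀ i ≥ n, (coordDiv b j ^ i) a = 0 := by
  have h (i : ℕ) (m : ι →₀ ℕ) :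
      (SymmetricAlgebra.equivMvPolynomial b ((coordDiv b j ^ i) a)).coeff m =
        (SymmetricAlgebra.equivMvPolynomial b a).coeff (Finsupp.single j i + m) := by
    induction i generalizing m with
    | zero => simp
    | succ i ih =>
      rw [pow_succ', Module.End.mul_apply, equivMvPolynomial_coordDiv, coeff_divX, ih, ← add_assoc,
        ← Finsupp.single_add]
  refine ⟨(SymmetricAlgebra.equivMvPolynomial b a).totalDegree + 1, fun i hi => ?_⟩
  apply (SymmetricAlgebra.equivMvPolynomial b).injective
  ext m
  rw [h, map_zero, coeff_zero]
  apply coeff_eq_zero_of_totalDegree_lt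
  have hj : (Finsupp.single j i + m) j = i + m j := by simp
  refine lt_of_lt_of_le ?_ (Finset.single_le_sum (fun _ _ => Nat.zero_le _)
    (Finsupp.mem_support_iff.2 (show (Finsupp.single j i + m) j ≠ 0 by rw [hj]; omega)))
  rw [hj]
  omega

end CoordDiv

section CoinducedAcyclic

variable {k : Type*} [CommRing k] {W : Type*} [AddCommGroup W] [Module k W]
variable {ι : Type*} (b : Module.Basis ι k W)
variable {M : Type*} [AddCommGroup M] [Module k M] [Module (SymmetricAlgebra k W) M]
  [IsScalarTower k (SymmetricAlgebra k W) M]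

local notation "x" => SymmetricAlgebra.ι k W

theorem coordDiv_pow_mul_of_ne {j l : ι} (h : l ≠ j) (i : ℕ) (a : SymmetricAlgebra k W) :
    (coordDiv b j ^ i) (x (b l) * a) = x (b l) * (coordDiv b j ^ i) a := by
  induction i with
  | zero => rfl
  | succ i ih =>
    rw [pow_succ', Module.End.mul_apply, Module.End.mul_apply, ih, coordDiv_mul_of_ne b h]

omit [IsScalarTower k (SymmetricAlgebra k W) M] in
theorem finsum_coordDiv_eq_sum (j : ι) (f : CoinducedBimodule k (SymmetricAlgebra k W) M)
    (a : SymmetricAlgebra k W) {n : ℕ} (hn : ∀ i ≥ n, (coordDiv b j ^ i) a = 0) :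
    ∑ᶠ i : ℕ, x (b j) ^ i • f ((coordDiv b j ^ (i + 1)) a) =
      ∑ i ∈ Finset.range n, x (b j) ^ i • f ((coordDiv b j ^ (i + 1)) a) := by
  refine finsum_eq_sum_of_support_subset _ fun i hi => ?_
  by_contra h
  refine hi ?_
  simp only [Finset.coe_range, Set.mem_Iio, not_lt] at h
  simp only
  rw [hn (i + 1) (h.trans (Nat.le_succ i)), map_zero, smul_zero]

/-- The solution `F` of `x_j F(a) - F(x_j a) = f(a)`, where `x_j = b j`, that vanishes on monomials
not divisible by `x_j`. -/
noncomputable def coinducedInverseFun (j : ι)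
    (f : CoinducedBimodule k (SymmetricAlgebra k W) M) :
    CoinducedBimodule k (SymmetricAlgebra k W) M :=
  have : SMulCommClass k (SymmetricAlgebra k W) M := IsScalarTower.to_smulCommClass
  { toFun a := -∑ᶠ i : ℕ, x (b j) ^ i • f ((coordDiv b j ^ (i + 1)) a)
    map_add' a a' := by
      obtain ⟨n, hn⟩ := exists_coordDiv_pow_eq_zero b j a
      obtain ⟨n', hn'⟩ := exists_coordDiv_pow_eq_zero b j a'
      rw [finsum_coordDiv_eq_sum b j f a (n := max n n') fun i hi => hn i (by omega),
        finsum_coordDiv_eq_sum b j f a' (n := max n n') fun i hi => hn' i (by omega),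
        finsum_coordDiv_eq_sum b j f (a + a') (n := max n n') fun i hi => by
          rw [map_add, hn i (by omega), hn' i (by omega), add_zero]]
      simp only [map_add, smul_add, Finset.sum_add_distrib, neg_add]
    map_smul' t a := by
      obtain ⟨n, hn⟩ := exists_coordDiv_pow_eq_zero b j a
      rw [finsum_coordDiv_eq_sum b j f a hn, finsum_coordDiv_eq_sum b j f (t • a) fun i hi => by
        rw [map_smul, hn i hi, smul_zero]]
      simp only [map_smul, smul_comm _ t, Finset.smul_sum, smul_neg, RingHom.id_apply] }

theorem coinducedInverseFun_apply (j : ι) (f : CoinducedBimodule k (SymmetricAlgebra k W) M)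
    (a : SymmetricAlgebra k W) {n : ℕ} (hn : ∀ i ≥ n, (coordDiv b j ^ i) a = 0) :
    coinducedInverseFun b j f a =
      -∑ i ∈ Finset.range n, x (b j) ^ i • f ((coordDiv b j ^ (i + 1)) a) :=
  congrArg Neg.neg (finsum_coordDiv_eq_sum b j f a hn)

/-- `coinducedInverseFun` as a linear map: a right inverse of the commutator with `b j` on
coinduced values. -/
noncomputable def coinducedInverse (j : ι) :
    CoinducedBimodule k (SymmetricAlgebra k W) M →ₗ[k]
      CoinducedBimodule k (SymmetricAlgebra k W) M where
  toFun := coinducedInverseFun b j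
  map_add' f f' := CoinducedBimodule.ext fun a => by
    obtain ⟨n, hn⟩ := exists_coordDiv_pow_eq_zero b j a
    simp only [CoinducedBimodule.add_apply, coinducedInverseFun_apply b j _ a hn, smul_add,
      Finset.sum_add_distrib, neg_add]
  map_smul' t f := CoinducedBimodule.ext fun a => by
    have : SMulCommClass k (SymmetricAlgebra k W) M := IsScalarTower.to_smulCommClass
    obtain ⟨n, hn⟩ := exists_coordDiv_pow_eq_zero b j a
    simp only [CoinducedBimodule.smul_apply, coinducedInverseFun_apply b j _ a hn, smul_comm _ t,
      Finset.smul_sum, smul_neg, RingHom.id_apply]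

theorem coinducedInverse_apply (j : ι) (f : CoinducedBimodule k (SymmetricAlgebra k W) M)
    (a : SymmetricAlgebra k W) {n : ℕ} (hn : ∀ i ≥ n, (coordDiv b j ^ i) a = 0) :
    coinducedInverse b j f a =
      -∑ i ∈ Finset.range n, x (b j) ^ i • f ((coordDiv b j ^ (i + 1)) a) :=
  coinducedInverseFun_apply b j f a hn

theorem commutatorMap_coinduced_apply (w : W)
    (f : CoinducedBimodule k (SymmetricAlgebra k W) M) (a : SymmetricAlgebra k W) :
    commutatorMap x (CoinducedBimodule k (SymmetricAlgebra k W) M) w f a =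
      x w • f a - f (x w * a) := rfl

theorem commutatorMap_coinducedInverse (j : ι)
    (f : CoinducedBimodule k (SymmetricAlgebra k W) M) :
    commutatorMap x _ (b j) (coinducedInverse b j f) = f := by
  ext a
  obtain ⟨n, hn⟩ := exists_coordDiv_pow_eq_zero b j a
  have h (i : ℕ) : (coordDiv b j ^ (i + 1)) (x (b j) * a) = (coordDiv b j ^ i) a := by
    rw [pow_succ, Module.End.mul_apply, coordDiv_mul_self]
  rw [commutatorMap_coinduced_apply, coinducedInverse_apply b j f a hn,
    coinducedInverse_apply b j f _ (n := n + 1) fun i hi => by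
      obtain ⟨i, rfl⟩ := Nat.exists_eq_add_of_le' (Nat.one_le_of_lt hi)
      rw [h, hn i (Nat.le_of_succ_le_succ hi)], Finset.sum_range_succ']
  simp only [h, smul_neg, Finset.smul_sum, smul_smul, ← pow_succ', pow_zero, one_smul]
  simp

theorem commutatorMap_coinducedInverse_of_ne {j l : ι} (hl : l ≠ j)
    (f : CoinducedBimodule k (SymmetricAlgebra k W) M) :
    commutatorMap x _ (b l) (coinducedInverse b j f) =
      coinducedInverse b j (commutatorMap x _ (b l) f) := by
  ext a
  obtain ⟨n, hn⟩ := exists_coordDiv_pow_eq_zero b j a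
  rw [commutatorMap_coinduced_apply, coinducedInverse_apply b j f a hn,
    coinducedInverse_apply b j _ a hn,
    coinducedInverse_apply b j f _ (n := n) fun i hi => by
      rw [coordDiv_pow_mul_of_ne b hl, hn i hi, mul_zero]]
  simp only [commutatorMap_coinduced_apply, coordDiv_pow_mul_of_ne b hl, smul_sub,
    Finset.sum_sub_distrib, Finset.smul_sum, smul_neg, smul_comm (x (b l))]
  abel

end CoinducedAcyclic

theorem SymmetricAlgebra.adjoin_range_ι (k W : Type*) [CommRing k] [AddCommGroup W] [Module k W] :
    Algebra.adjoin k (Set.range (SymmetricAlgebra.ι k W)) = ⊤ := by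
  refine eq_top_iff.2 fun a _ => ?_
  induction a using SymmetricAlgebra.induction with
  | algebraMap t => exact Subalgebra.algebraMap_mem _ t
  | ι w => exact Algebra.subset_adjoin ⟨w, rfl⟩
  | mul a a' ha ha' => exact mul_mem (ha trivial) (ha' trivial)
  | add a a' ha ha' => exact add_mem (ha trivial) (ha' trivial)

/-- Over a polynomial algebra in finitely many variables, antisymmetrization on linear functions
computes Hochschild cohomology by the Koszul complex. -/
theorem antisymmetrizeBijective_symmetricAlgebra.{u, v} {k : Type u} [Field k] {W : Type v}
    [AddCommGroup W] [Module k W] [FiniteDimensional k W] (n : ℕ)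
    (M : Type (max u v)) [AddCommGroup M] [Module k M] [Module (SymmetricAlgebra k W) M]
    [Module (SymmetricAlgebra k W)ᵐᵒᵖ M] [IsScalarTower k (SymmetricAlgebra k W) M]
    [IsScalarTower k (SymmetricAlgebra k W)ᵐᵒᵖ M]
    [SMulCommClass (SymmetricAlgebra k W) (SymmetricAlgebra k W)ᵐᵒᵖ M] :
    AntisymmetrizeBijective (SymmetricAlgebra.ι k W) M n := by
  refine antisymmetrizeBijective_of_coinduced _ (SymmetricAlgebra.adjoin_range_ι k W) ?_ n M
  intro M _ _ _ _ n κ hκ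
  exact exists_koszulD_eq_of_rightInverse _ (Module.finBasis k W) (coinducedInverse _)
    (commutatorMap_coinducedInverse _) (fun j l hl => commutatorMap_coinducedInverse_of_ne _ hl)
    κ hκ

/-! ### Multivectors as alternating maps on the dual space -/

section Multivectors

open Set

variable {k : Type*} [Field k] {V : Type*} [AddCommGroup V] [Module k V]
variable (F : Type*) [AddCommGroup F] [Module k F]

/-- The element `t` of `Λ^n V ⊗ F` as an alternating map on `V*` with values in `F`. -/
noncomputable def contractAlternating (n : ℕ) :
    (⋀[k]^n V) ⊗[k] F →ₗ[k] (Module.Dual k V [⋀^Fin n]→ₗ[k] F) where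
  toFun t := ((LinearMap.applyₗ t ∘ₗ LinearMap.llcomp k _ _ _ (TensorProduct.lid k F).toLinearMap ∘ₗ
    LinearMap.rTensorHom F) ∘ₗ exteriorPower.pairingDual k V n).compAlternatingMap
      (exteriorPower.ιMulti k n)
  map_add' t t' := by ext; simp
  map_smul' c t := by ext; simp

theorem contractAlternating_apply {n : ℕ} (t : (⋀[k]^n V) ⊗[k] F) (y : Fin n → Module.Dual k V) :
    contractAlternating F n t y = contractWith F y t := rfl

theorem contractWith_tmul {n : ℕ} (y : Fin n → Module.Dual k V) (ξ : ⋀[k]^n V) (f : F) :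
    contractWith F y (ξ ⊗ₜ f) =
      exteriorPower.pairingDual k V n (exteriorPower.ιMulti k n y) ξ • f :=
  rfl

variable {ι : Type*} [LinearOrder ι] [Finite ι] (b : Module.Basis ι k V)

omit [Finite ι] in
theorem equivFinsuppOfBasisLeft_exteriorPower {n : ℕ} (t : (⋀[k]^n V) ⊗[k] F)
    (s : powersetCard ι n) :
    TensorProduct.equivFinsuppOfBasisLeft (b.exteriorPower n) t s =
      contractWith F (fun i => b.coord (powersetCard.ofFinEmbEquiv.symm s i)) t := by
  rw [TensorProduct.equivFinsuppOfBasisLeft_apply, exteriorPower.basis_coord]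
  rfl

include b in
theorem contractAlternating_bijective (n : ℕ) :
    Function.Bijective (contractAlternating (k := k) (V := V) F n) := by
  have := Fintype.ofFinite ι
  let e := TensorProduct.equivFinsuppOfBasisLeft (N := F) (b.exteriorPower n)
  constructor
  · refine (injective_iff_map_eq_zero _).2 fun t ht => ?_
    apply e.injective
    ext s
    rw [equivFinsuppOfBasisLeft_exteriorPower, ← contractAlternating_apply, ht, map_zero]
    rfl
  · intro κ
    let t := e.symm (Finsupp.equivFunOnFinite.symm fun s : powersetCard ι n =>
      κ fun i => b.coord (powersetCard.ofFinEmbEquiv.symm s i))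
    have ht (s : powersetCard ι n) :
        contractWith F (fun i => b.coord (powersetCard.ofFinEmbEquiv.symm s i)) t =
          κ fun i => b.coord (powersetCard.ofFinEmbEquiv.symm s i) := by
      rw [← equivFinsuppOfBasisLeft_exteriorPower]
      exact DFunLike.congr_fun (e.apply_symm_apply _) s
    refine ⟨t, exteriorPower.alternatingMapLinearEquiv.injective ?_⟩
    refine (b.dualBasis.exteriorPower n).ext fun s => ?_
    rw [exteriorPower.basis_apply, exteriorPower.ιMulti_family,
      exteriorPower.alternatingMapLinearEquiv_apply_ιMulti,
      exteriorPower.alternatingMapLinearEquiv_apply_ιMulti]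
    have h : (b.dualBasis ∘ powersetCard.ofFinEmbEquiv.symm s) =
        fun i => b.coord (powersetCard.ofFinEmbEquiv.symm s i) := by
      ext
      simp
    rw [h, contractAlternating_apply, ht]

end Multivectors

/-! ### The wedge product of two complementary subspaces -/

section WedgeSub

open Set exteriorPower

variable {k : Type*} [Field k] {V : Type*} [AddCommGroup V] [Module k V]
variable {U W : Submodule k V}

theorem wedgeSub_ιMulti_tmul_ιMulti {p q : ℕ} (u : Fin p → U) (w : Fin q → W) :
    wedgeSub U W p q (ιMulti k p u ⊗ₜ ιMulti k q w) =
      ιMulti k (p + q) (Fin.append (fun i => (u i : V)) fun i => (w i : V)) := by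
  apply Subtype.ext
  change (exteriorPower.map p U.subtype (ιMulti k p u) : ExteriorAlgebra k V) *
    (exteriorPower.map q W.subtype (ιMulti k q w) : ExteriorAlgebra k V) = _
  rw [map_apply_ιMulti, map_apply_ιMulti]
  simp only [ιMulti_apply_coe, ExteriorAlgebra.ιMulti_apply]
  rw [← List.prod_append, ← List.ofFn_fin_append]
  congr 2
  funext i
  cases i using Fin.addCases <;> simp

theorem Fin.append_castAdd_natAdd_strictMono {p q a d : ℕ} {I : Fin p → Fin a} {J : Fin q → Fin d}
    (hI : StrictMono I) (hJ : StrictMono J) :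
    StrictMono (Fin.append (fun i => Fin.castAdd d (I i)) fun i => Fin.natAdd a (J i)) := by
  intro i j hij
  cases i using Fin.addCases with
  | left i =>
    cases j using Fin.addCases with
    | left j =>
      rw [Fin.append_left, Fin.append_left]
      exact hI ((Fin.strictMono_castAdd q).lt_iff_lt.1 hij)
    | right j => simp [Fin.lt_def]; omega
  | right i =>
    cases j using Fin.addCases with
    | left j => simp [Fin.lt_def] at hij; omega
    | right j => simpa using hJ (by simpa using hij)

variable {a d : ℕ} (b : Module.Basis (Fin (a + d)) k V) (bU : Module.Basis (Fin a) k U)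
  (bW : Module.Basis (Fin d) k W) (hU : ∀ i, b (Fin.castAdd d i) = bU i)
  (hW : ∀ i, b (Fin.natAdd a i) = bW i)

include hU hW

theorem wedgeSub_basis {p q : ℕ} (I : Fin p → Fin a) (J : Fin q → Fin d) :
    wedgeSub U W p q (ιMulti k p (bU ∘ I) ⊗ₜ ιMulti k q (bW ∘ J)) =
      ιMulti k (p + q)
        (b ∘ Fin.append (fun i => Fin.castAdd d (I i)) fun i => Fin.natAdd a (J i)) := by
  rw [wedgeSub_ιMulti_tmul_ιMulti]
  congr 1
  funext i
  cases i using Fin.addCases <;> simp [hU, hW]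

theorem exists_wedgeSub_tensorProduct_basis (p q : ℕ) :
    ∃ φ : powersetCard (Fin a) p × powersetCard (Fin d) q → powersetCard (Fin (a + d)) (p + q),
      Function.Injective φ ∧ ∀ s,
        wedgeSub U W p q ((bU.exteriorPower p).tensorProduct (bW.exteriorPower q) s) =
          b.exteriorPower (p + q) (φ s) := by
  let E (s : powersetCard (Fin a) p × powersetCard (Fin d) q) : Fin (p + q) ↪o Fin (a + d) :=
    OrderEmbedding.ofStrictMono _
      (Fin.append_castAdd_natAdd_strictMono (powersetCard.ofFinEmbEquiv.symm s.1).strictMono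
        (powersetCard.ofFinEmbEquiv.symm s.2).strictMono)
  refine ⟨fun s => powersetCard.ofFinEmbEquiv (E s), fun s t hst => ?_, fun s => ?_⟩
  · have h := powersetCard.ofFinEmbEquiv.injective hst
    refine Prod.ext (powersetCard.ofFinEmbEquiv.symm.injective (DFunLike.ext _ _ fun i => ?_))
      (powersetCard.ofFinEmbEquiv.symm.injective (DFunLike.ext _ _ fun i => ?_))
    · simpa [E] using DFunLike.congr_fun h (Fin.castAdd q i)
    · simpa [E] using DFunLike.congr_fun h (Fin.natAdd p i)
  · rw [Module.Basis.tensorProduct_apply, basis_apply, basis_apply, basis_apply]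
    refine (wedgeSub_basis b bU bW hU hW _ _).trans ?_
    rw [ιMulti_family, Equiv.symm_apply_apply]
    rfl

theorem wedgeSub_injective (p q : ℕ) : Function.Injective (wedgeSub U W p q) := by
  obtain ⟨φ, hφ, h⟩ := exists_wedgeSub_tensorProduct_basis b bU bW hU hW p q
  let B := (bU.exteriorPower p).tensorProduct (bW.exteriorPower q)
  have hcoord (s) : (b.exteriorPower (p + q)).coord (φ s) ∘ₗ wedgeSub U W p q = B.coord s :=
    B.ext fun t => by
      classical
      rw [LinearMap.comp_apply, h, Module.Basis.coord_apply, Module.Basis.coord_apply,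
        Module.Basis.repr_self, Module.Basis.repr_self, Finsupp.single_apply, Finsupp.single_apply]
      simp only [hφ.eq_iff]
  refine (injective_iff_map_eq_zero _).2 fun z hz => B.ext_elem fun s => ?_
  rw [← Module.Basis.coord_apply, ← hcoord, LinearMap.comp_apply, hz]
  simp

/-- A multivector with a factor in `Λ^{dim W} W` pairs to zero with tuples of coordinates that
omit a coordinate of `W`. -/
theorem contractWith_rTensor_wedgeSub_eq_zero (F : Type*) [AddCommGroup F] [Module k F] {p : ℕ}
    (t : (⋀[k]^p U ⊗[k] ⋀[k]^d W) ⊗[k] F) (v : Fin (p + d) → Fin (a + d)) (m : Fin d)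
    (hm : Fin.natAdd a m ∉ range v) :
    contractWith F (fun i => b.coord (v i)) (LinearMap.rTensor F (wedgeSub U W p d) t) = 0 := by
  have h : pairingDual k V (p + d) (ιMulti k (p + d) fun i => b.coord (v i)) ∘ₗ
      wedgeSub U W p d = 0 := by
    refine ((bU.exteriorPower p).tensorProduct (bW.exteriorPower d)).ext fun s => ?_
    rw [Module.Basis.tensorProduct_apply, basis_apply, basis_apply, LinearMap.comp_apply]
    unfold ιMulti_family
    rw [wedgeSub_basis b bU bW hU hW, pairingDual_ιMulti_ιMulti]
    obtain ⟨i, hi⟩ := Finite.injective_iff_surjective.1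
      (powersetCard.ofFinEmbEquiv.symm s.2).injective m
    refine Matrix.det_eq_zero_of_row_eq_zero (Fin.natAdd p i) fun j => ?_
    simp only [Matrix.of_apply, Function.comp_apply, Fin.append_right, hi, Module.Basis.coord_apply,
      Module.Basis.repr_self]
    exact Finsupp.single_eq_of_ne fun h => hm ⟨j, h⟩
  induction t with
  | zero => rw [map_zero, map_zero]
  | add t t' ht ht' => rw [map_add, map_add, ht, ht', add_zero]
  | tmul z f =>
    rw [LinearMap.rTensor_tmul, contractWith_tmul]
    have := LinearMap.congr_fun h z
    rw [LinearMap.comp_apply] at this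
    rw [this, LinearMap.zero_apply, zero_smul]

omit hU hW in
theorem Fin.add_le_of_strictMono {m n : ℕ} {f : Fin m → Fin n} (hf : StrictMono f) (i : Fin m) :
    (f i : ℕ) + m ≤ n + i := by
  induction h : m - 1 - (i : ℕ) generalizing i with
  | zero => have := (f i).2; omega
  | succ r ih =>
    have h1 := ih ⟨i + 1, by omega⟩ (by simp; omega)
    have h2 : f i < f ⟨i + 1, by omega⟩ := hf (by simp [Fin.lt_def])
    simp only [Fin.lt_def] at h1 h2
    omega

omit hU hW in
/-- A strictly increasing sequence in `{0, …, a + d - 1}` that takes the last `d` values takes them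
at its last `d` places. -/
theorem Fin.exists_eq_append_of_strictMono {p a d : ℕ} {f : Fin (p + d) → Fin (a + d)}
    (hf : StrictMono f) (h : ∀ m, Fin.natAdd a m ∈ range f) :
    ∃ I : Fin p → Fin a, f = Fin.append (fun i => Fin.castAdd d (I i)) fun i => Fin.natAdd a i := by
  choose g hg using h
  have hgm : StrictMono g := fun i j hij => hf.lt_iff_lt.1 (by simpa [hg] using hij)
  have hr (m : Fin d) : f (Fin.natAdd p m) = Fin.natAdd a m := by
    have h1 := Fin.add_le_of_strictMono hgm m
    have h2 := Fin.add_le_of_strictMono hf (g m)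
    rw [hg] at h2
    have h3 : g m = Fin.natAdd p m := Fin.ext (by simp at h2 ⊢; omega)
    rw [← h3, hg]
  have hl (i : Fin p) : (f (Fin.castAdd d i) : ℕ) < a := by
    by_contra! hlt
    have h1 := hr ⟨f (Fin.castAdd d i) - a, by omega⟩
    have h2 := hf.injective (h1.trans (Fin.ext (by simp; omega)) :
      f (Fin.natAdd p _) = f (Fin.castAdd d i))
    simp [Fin.ext_iff] at h2
    omega
  refine ⟨fun i => ⟨_, hl i⟩, funext fun i => ?_⟩
  cases i using Fin.addCases with
  | left i => simp
  | right i => simp [hr]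

/-- An element of `Λ^{p + d} V ⊗ F` comes from `Λ^p U ⊗ Λ^d W ⊗ F`, with `d = dim W`, as soon as its
coefficients vanish at the basis multivectors that omit a basis vector of `W`. -/
theorem mem_range_rTensor_wedgeSub (F : Type*) [AddCommGroup F] [Module k F] {p : ℕ}
    (t : (⋀[k]^(p + d) V) ⊗[k] F)
    (ht : ∀ v : Fin (p + d) → Fin (a + d), Function.Injective v →
      ∀ m, Fin.natAdd a m ∉ range v → contractWith F (fun i => b.coord (v i)) t = 0) :
    t ∈ LinearMap.range (LinearMap.rTensor F (wedgeSub U W p d)) := by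
  let e := TensorProduct.equivFinsuppOfBasisLeft (N := F) (b.exteriorPower (p + d))
  rw [← e.symm_apply_apply t, TensorProduct.equivFinsuppOfBasisLeft_symm_apply]
  refine Submodule.finsuppSum_mem _ _ _ _ fun s hs => ?_
  rw [equivFinsuppOfBasisLeft_exteriorPower] at hs ⊢
  have hmem (m : Fin d) : Fin.natAdd a m ∈ range (powersetCard.ofFinEmbEquiv.symm s) := by
    by_contra hm
    exact hs (ht _ (powersetCard.ofFinEmbEquiv.symm s).injective m hm)
  obtain ⟨I, hI⟩ := Fin.exists_eq_append_of_strictMono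
    (powersetCard.ofFinEmbEquiv.symm s).strictMono hmem
  refine ⟨(ιMulti k p (bU ∘ I) ⊗ₜ ιMulti k d (bW ∘ id)) ⊗ₜ
    contractWith F (fun i => b.coord (powersetCard.ofFinEmbEquiv.symm s i)) t, ?_⟩
  rw [LinearMap.rTensor_tmul, wedgeSub_basis b bU bW hU hW, basis_apply, ιMulti_family, hI]
  rfl

end WedgeSub

/-! ### Eigenbases of a group element -/

section Eigenbasis

variable {k : Type*} [Field k] {V : Type*} [AddCommGroup V] [Module k V]

theorem Module.End.exists_eigenbasis.{u, v} {k : Type u} [Field k] {V : Type v} [AddCommGroup V]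
    [Module k V] (f : Module.End k V)
    (hf : ⨆ μ : k, f.eigenspace μ = ⊤) :
    ∃ (ι : Type v) (e : Module.Basis ι k V) (μ : ι → k), ∀ i, f (e i) = μ i • e i := by
  let S : Set V := ⋃ μ : k, f.eigenspace μ
  have hS : ⊤ ≤ Submodule.span k S := by
    rw [← hf]
    exact iSup_le fun μ v hv => Submodule.subset_span (Set.mem_iUnion.2 ⟨μ, hv⟩)
  have h (i) : ∃ μ : k, f (Module.Basis.ofSpan hS i) = μ • Module.Basis.ofSpan hS i := by
    obtain ⟨μ, hμ⟩ := Set.mem_iUnion.1 (Module.Basis.ofSpan_subset hS ⟨i, rfl⟩)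
    exact ⟨μ, Module.End.mem_eigenspace_iff.1 hμ⟩
  choose μ hμ using h
  exact ⟨_, Module.Basis.ofSpan hS, fun i => μ i, fun i => hμ i⟩

theorem Module.End.mem_span_of_eigenbasis {ι : Type*} (e : Module.Basis ι k V) {f : Module.End k V}
    {μ : ι → k} (he : ∀ i, f (e i) = μ i • e i) {ν : k} {v : V} (hv : f v = ν • v) :
    v ∈ Submodule.span k (e '' {i | μ i = ν}) := by
  have h (i : ι) : μ i * e.repr v i = ν * e.repr v i := by
    have h1 : (e.coord i) ∘ₗ f = μ i • e.coord i := e.ext fun j => by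
      classical
      rw [LinearMap.comp_apply, he, LinearMap.smul_apply, map_smul, e.coord_apply, e.repr_self,
        Finsupp.single_apply]
      split_ifs with hij
      · rw [hij]
      · simp
    have h2 := LinearMap.congr_fun h1 v
    rw [LinearMap.comp_apply, hv, map_smul] at h2
    exact h2.symm
  refine (e.mem_span_image).2 fun i hi => ?_
  exact mul_right_cancel₀ (Finsupp.mem_support_iff.1 hi) (h i)

theorem iSup_eigenspace_representation [IsAlgClosed k] [FiniteDimensional k V] {G : Type*} [Group G]
    [Finite G] (ρ : Representation k G V) (hG : (Nat.card G : k) ≠ 0) (g : G) :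
    ⨆ μ : k, Module.End.eigenspace (ρ g) μ = ⊤ := by
  refine Module.End.IsSemisimple.iSup_eigenspace_eq_top
    (Module.End.isSemisimple_of_squarefree_aeval_eq_zero
      (Polynomial.X_pow_sub_one_separable_iff.2 hG).squarefree ?_)
  rw [map_sub, map_pow, Polynomial.aeval_X, map_one, ← map_pow, pow_card_eq_one', map_one, sub_self]

/-- A basis of `V` made of a basis of `V^g` followed by a basis of eigenvectors of `g` with
eigenvalues different from one. -/
structure AdaptedBasis {G : Type*} [Group G] (ρ : Representation k G V) (g : G) (a : ℕ) where
  /-- the basis of the whole space -/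
  basis : Module.Basis (Fin (a + fixedCodim ρ g)) k V
  /-- the basis of the invariant vectors -/
  fixedBasis : Module.Basis (Fin a) k (fixedSpace ρ g)
  /-- the basis of the complement -/
  movedBasis : Module.Basis (Fin (fixedCodim ρ g)) k (movedSpace ρ g)
  /-- the eigenvalues on the complement -/
  eigenvalue : Fin (fixedCodim ρ g) → k
  basis_castAdd : ∀ i, basis (Fin.castAdd _ i) = fixedBasis i
  basis_natAdd : ∀ i, basis (Fin.natAdd a i) = movedBasis i
  eigenvalue_ne_one : ∀ i, eigenvalue i ≠ 1
  apply_natAdd : ∀ i, ρ g (basis (Fin.natAdd a i)) = eigenvalue i • basis (Fin.natAdd a i)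

theorem exists_adaptedBasis [FiniteDimensional k V] {G : Type*} [Group G]
    (ρ : Representation k G V) (g : G) (h : ⨆ μ : k, Module.End.eigenspace (ρ g) μ = ⊤) :
    ∃ a, Nonempty (AdaptedBasis ρ g a) := by
  classical
  obtain ⟨ι, e, μ, he⟩ := Module.End.exists_eigenbasis (ρ g) h
  have := FiniteDimensional.fintypeBasisIndex e
  have hfixed : Submodule.span k (Set.range fun i : {i // μ i = 1} => e i) = fixedSpace ρ g := by
    apply le_antisymm
    · rw [Submodule.span_le]
      rintro _ ⟨i, rfl⟩
      change ρ g (e i) = e i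
      rw [he, i.2, one_smul]
    · intro v hv
      have := Module.End.mem_span_of_eigenbasis e he (ν := 1) (v := v) (by rw [one_smul]; exact hv)
      rwa [Set.image_eq_range] at this
  have hmoved : Submodule.span k (Set.range fun i : {i // ¬μ i = 1} => e i) = movedSpace ρ g := by
    apply le_antisymm
    · rw [Submodule.span_le]
      rintro _ ⟨i, rfl⟩
      exact Submodule.mem_iSup_of_mem (μ i) (Submodule.mem_iSup_of_mem i.2
        (Module.End.mem_eigenspace_iff.2 (he i)))
    · refine iSup_le fun ν => iSup_le fun hν v hv => ?_
      refine Submodule.span_mono ?_ (Module.End.mem_span_of_eigenbasis e he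
        (Module.End.mem_eigenspace_iff.1 hv))
      rintro _ ⟨i, hi, rfl⟩
      exact ⟨⟨i, fun h => hν (hi.symm.trans h)⟩, rfl⟩
  let bU : Module.Basis {i // μ i = 1} k (fixedSpace ρ g) :=
    (Module.Basis.span (e.linearIndependent.comp _ Subtype.val_injective)).map
      (LinearEquiv.ofEq _ _ hfixed)
  let bW : Module.Basis {i // ¬μ i = 1} k (movedSpace ρ g) :=
    (Module.Basis.span (e.linearIndependent.comp _ Subtype.val_injective)).map
      (LinearEquiv.ofEq _ _ hmoved)
  have hbU (i) : (bU i : V) = e i := by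
    simp [bU, Module.Basis.span_apply]
  have hbW (i) : (bW i : V) = e i := by
    simp [bW, Module.Basis.span_apply]
  have hd : Fintype.card {i // ¬μ i = 1} = fixedCodim ρ g := by
    have h1 := (fixedSpace ρ g).finrank_quotient_add_finrank
    rw [Module.finrank_eq_card_basis bU, Module.finrank_eq_card_basis e,
      ← Fintype.card_congr (Equiv.sumCompl fun i => μ i = 1), Fintype.card_sum] at h1
    unfold fixedCodim
    omega
  let r₁ := Fintype.equivFin {i // μ i = 1}
  let r₂ := Fintype.equivFinOfCardEq hd
  let r := ((Equiv.sumCompl fun i => μ i = 1).symm.trans (Equiv.sumCongr r₁ r₂)).trans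
    finSumFinEquiv
  have hr₁ (i) : e.reindex r (Fin.castAdd _ i) = e (r₁.symm i) := by simp [r]
  have hr₂ (i) : e.reindex r (Fin.natAdd _ i) = e (r₂.symm i) := by simp [r]
  exact ⟨_, ⟨{
    basis := e.reindex r
    fixedBasis := bU.reindex r₁
    movedBasis := bW.reindex r₂
    eigenvalue := fun i => μ (r₂.symm i)
    basis_castAdd := fun i => by rw [hr₁, Module.Basis.reindex_apply, hbU]
    basis_natAdd := fun i => by rw [hr₂, Module.Basis.reindex_apply, hbW]
    eigenvalue_ne_one := fun i => (r₂.symm i).2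
    apply_natAdd := fun i => by rw [hr₂, he] }⟩⟩

end Eigenbasis

/-! ### Coordinates adapted to a group element -/

section AdaptedCoordinates

open SymmetricAlgebra

theorem MvPolynomial.aeval_ite_eq_self {k ι : Type*} [CommSemiring k] (S : Set ι)
    [DecidablePred (· ∈ S)] (p : MvPolynomial ι k)
    (hp : ∀ j ∈ S, ∀ m : ι →₀ ℕ, m j ≠ 0 → p.coeff m = 0) :
    MvPolynomial.aeval (fun j => if j ∈ S then 0 else MvPolynomial.X j) p = p := by
  conv_lhs => rw [p.as_sum]
  conv_rhs => rw [p.as_sum]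
  rw [map_sum]
  refine Finset.sum_congr rfl fun m hm => ?_
  rw [MvPolynomial.aeval_monomial, MvPolynomial.monomial_eq, MvPolynomial.algebraMap_eq]
  congr 1
  refine Finsupp.prod_congr fun j hj => ?_
  rw [if_neg fun hS => MvPolynomial.mem_support_iff.1 hm (hp j hS m (Finsupp.mem_support_iff.1 hj))]

variable {k : Type*} [Field k] {V : Type*} [AddCommGroup V] [Module k V]
variable {G : Type*} [Group G] {ρ : Representation k G V} {g : G} {a : ℕ}

theorem polyRestrict_ι (U : Submodule k V) (φ : Module.Dual k V) :
    polyRestrict U (ι k _ φ) = ι k _ (U.dualRestrict φ) := by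
  simp [polyRestrict]

theorem polyAct_ι (φ : Module.Dual k V) : polyAct ρ g (ι k _ φ) = ι k _ (ρ.dual g φ) := by
  simp [polyAct]

theorem commutatorMap_restricted (U : Submodule k V) (φ : Module.Dual k V)
    (m : RestrictedBimodule U) : commutatorMap (ι k _) _ φ m = 0 := by
  obtain ⟨m, rfl⟩ := (PullbackBimodule.of _ _).surjective m
  rw [commutatorMap_apply, PullbackBimodule.smul_of, PullbackBimodule.op_smul_of, mul_comm,
    sub_self]

namespace AdaptedBasis

variable (B : AdaptedBasis ρ g a)

/-- The coordinate functions of an adapted basis. -/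
noncomputable def coords : Module.Basis (Fin (a + fixedCodim ρ g)) k (Module.Dual k V) :=
  B.basis.dualBasis

theorem coords_apply (j : Fin (a + fixedCodim ρ g)) : B.coords j = B.basis.coord j := by
  ext
  simp [coords]

theorem dualRestrict_castAdd (i : Fin a) :
    (fixedSpace ρ g).dualRestrict (B.coords (Fin.castAdd _ i)) = B.fixedBasis.coord i := by
  refine B.fixedBasis.ext fun l => ?_
  rw [Submodule.dualRestrict_apply, coords_apply, ← B.basis_castAdd]
  simp [Finsupp.single_apply]

theorem dualRestrict_natAdd (i : Fin (fixedCodim ρ g)) :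
    (fixedSpace ρ g).dualRestrict (B.coords (Fin.natAdd a i)) = 0 := by
  refine B.fixedBasis.ext fun l => ?_
  rw [Submodule.dualRestrict_apply, coords_apply, ← B.basis_castAdd]
  simp [Finsupp.single_apply, Fin.ext_iff]
  omega

theorem eigenvalue_ne_zero (i : Fin (fixedCodim ρ g)) : B.eigenvalue i ≠ 0 := by
  intro h
  have h1 := B.apply_natAdd i
  rw [h, zero_smul] at h1
  refine B.basis.ne_zero (Fin.natAdd a i) ?_
  have h2 := ρ.inv_self_apply g (B.basis (Fin.natAdd a i))
  rw [h1, map_zero] at h2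
  exact h2.symm

theorem inv_apply_castAdd (i : Fin a) :
    ρ g⁻¹ (B.basis (Fin.castAdd _ i)) = B.basis (Fin.castAdd _ i) := by
  have h : ρ g (B.basis (Fin.castAdd _ i)) = B.basis (Fin.castAdd _ i) := by
    rw [B.basis_castAdd]
    exact (B.fixedBasis i).2
  conv_lhs => rw [← h]
  exact ρ.inv_self_apply g _

theorem inv_apply_natAdd (i : Fin (fixedCodim ρ g)) :
    ρ g⁻¹ (B.basis (Fin.natAdd a i)) = (B.eigenvalue i)⁻¹ • B.basis (Fin.natAdd a i) := by
  rw [← inv_smul_smul₀ (B.eigenvalue_ne_zero i) (B.basis (Fin.natAdd a i)), ← B.apply_natAdd,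
    map_smul, ρ.inv_self_apply, B.apply_natAdd, inv_smul_smul₀ (B.eigenvalue_ne_zero i)]

theorem dual_castAdd (i : Fin a) :
    ρ.dual g (B.coords (Fin.castAdd _ i)) = B.coords (Fin.castAdd _ i) := by
  refine B.basis.ext fun l => ?_
  rw [coords_apply]
  change B.basis.coord _ (ρ g⁻¹ (B.basis l)) = _
  cases l using Fin.addCases with
  | left l => rw [inv_apply_castAdd]
  | right l =>
    rw [inv_apply_natAdd, map_smul, B.basis.coord_apply, B.basis.repr_self,
      Finsupp.single_eq_of_ne, smul_zero]
    simp [Fin.ext_iff]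
    omega

theorem dual_natAdd (i : Fin (fixedCodim ρ g)) :
    ρ.dual g (B.coords (Fin.natAdd a i)) = (B.eigenvalue i)⁻¹ • B.coords (Fin.natAdd a i) := by
  refine B.basis.ext fun l => ?_
  rw [coords_apply, LinearMap.smul_apply]
  change B.basis.coord _ (ρ g⁻¹ (B.basis l)) = _
  cases l using Fin.addCases with
  | left l =>
    rw [inv_apply_castAdd, B.basis.coord_apply, B.basis.repr_self, Finsupp.single_eq_of_ne,
      smul_zero]
    simp [Fin.ext_iff]
    omega
  | right l =>
    rw [inv_apply_natAdd, map_smul]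
    rcases eq_or_ne l i with rfl | h
    · rfl
    · rw [B.basis.coord_apply, B.basis.repr_self, Finsupp.single_eq_of_ne, smul_zero, smul_zero]
      simpa [Fin.ext_iff] using Ne.symm (Fin.val_ne_of_ne h)

theorem commutatorMap_castAdd (i : Fin a) (m : TwistedBimodule ρ g) :
    commutatorMap (ι k _) _ (B.coords (Fin.castAdd _ i)) m = 0 := by
  obtain ⟨m, rfl⟩ := (PullbackBimodule.of _ _).surjective m
  rw [commutatorMap_apply, PullbackBimodule.smul_of, PullbackBimodule.op_smul_of, polyAct_ι,
    dual_castAdd, AlgHom.id_apply, mul_comm, sub_self]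

theorem commutatorMap_natAdd (i : Fin (fixedCodim ρ g)) (m : PolyFun k V) :
    commutatorMap (ι k _) (TwistedBimodule ρ g) (B.coords (Fin.natAdd a i))
        (PullbackBimodule.of _ _ m) =
      PullbackBimodule.of _ _
        ((1 - (B.eigenvalue i)⁻¹) • (ι k _ (B.coords (Fin.natAdd a i)) * m)) := by
  rw [commutatorMap_apply, PullbackBimodule.smul_of, PullbackBimodule.op_smul_of, polyAct_ι,
    dual_natAdd, AlgHom.id_apply, map_smul, mul_smul_comm, mul_comm m, ← map_sub, sub_smul,
    one_smul]

/-- Extension of polynomial functions from `V^g` to `V`, constant along the complement. -/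
noncomputable def extend : PolyFun k (fixedSpace ρ g) →ₐ[k] PolyFun k V :=
  lift (B.fixedBasis.dualBasis.constr k fun i => ι k _ (B.coords (Fin.castAdd _ i)))

theorem extend_ι (i : Fin a) :
    B.extend (ι k _ (B.fixedBasis.coord i)) = ι k _ (B.coords (Fin.castAdd _ i)) := by
  have h : B.fixedBasis.coord i = B.fixedBasis.dualBasis i := by ext; simp
  rw [extend, lift_ι_apply, h, Module.Basis.constr_basis]

theorem polyRestrict_extend (f : PolyFun k (fixedSpace ρ g)) :
    polyRestrict (fixedSpace ρ g) (B.extend f) = f := by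
  have h : (polyRestrict (fixedSpace ρ g)).comp B.extend = AlgHom.id k _ := by
    apply algHom_ext
    refine B.fixedBasis.dualBasis.ext fun i => ?_
    have hi : B.fixedBasis.dualBasis i = B.fixedBasis.coord i := by ext; simp
    change polyRestrict _ (B.extend (ι k _ (B.fixedBasis.dualBasis i))) =
      ι k _ (B.fixedBasis.dualBasis i)
    rw [hi, extend_ι, polyRestrict_ι, dualRestrict_castAdd]
  exact DFunLike.congr_fun h f

/-- Polynomials that do not involve the coordinates vanishing on `V^g` are determined by their
restriction to `V^g`. -/
theorem extend_polyRestrict (f : PolyFun k V)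
    (hf : ∀ i, coordDiv B.coords (Fin.natAdd a i) f = 0) :
    B.extend (polyRestrict (fixedSpace ρ g) f) = f := by
  classical
  let e := equivMvPolynomial B.coords
  let S : Set (Fin (a + fixedCodim ρ g)) := Set.range (Fin.natAdd a)
  let ev : MvPolynomial (Fin (a + fixedCodim ρ g)) k →ₐ[k]
      MvPolynomial (Fin (a + fixedCodim ρ g)) k :=
    MvPolynomial.aeval (fun j => if j ∈ S then 0 else MvPolynomial.X j)
  have h : (e.toAlgHom.comp (B.extend.comp (polyRestrict (fixedSpace ρ g)))) =
      ev.comp e.toAlgHom := by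
    apply algHom_ext
    refine B.coords.ext fun j => ?_
    change e (B.extend (polyRestrict _ (ι k _ (B.coords j)))) = ev (e (ι k _ (B.coords j)))
    rw [equivMvPolynomial_ι_apply, MvPolynomial.aeval_X, polyRestrict_ι]
    cases j using Fin.addCases with
    | left i =>
      rw [if_neg, dualRestrict_castAdd, extend_ι, equivMvPolynomial_ι_apply]
      rintro ⟨l, hl⟩
      simp [Fin.ext_iff] at hl
      omega
    | right i =>
      rw [if_pos ⟨i, rfl⟩, dualRestrict_natAdd]
      simp
  apply e.injective
  refine (DFunLike.congr_fun h f).trans (MvPolynomial.aeval_ite_eq_self S _ ?_)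
  rintro _ ⟨i, rfl⟩ m hm
  have h1 := congrArg (fun p => (e p).coeff (m - Finsupp.single (Fin.natAdd a i) 1)) (hf i)
  simp only [e, equivMvPolynomial_coordDiv, MvPolynomial.coeff_divX] at h1
  rw [add_tsub_cancel_of_le] at h1
  · simpa using h1
  · simpa [Nat.one_le_iff_ne_zero] using hm

end AdaptedBasis

end AdaptedCoordinates

/-! ### Hochschild cohomology of polynomial functions -/

section KoszulClass

variable {k : Type*} [CommRing k] {A : Type*} [CommRing A] [Algebra k A]
variable {W : Type*} [AddCommGroup W] [Module k W] (x : W →ₗ[k] A)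
variable {M : Type*} [AddCommGroup M] [Module k M] [Module A M] [Module Aᵐᵒᵖ M]
  [IsScalarTower k A M] [IsScalarTower k Aᵐᵒᵖ M]
  (hM : ∀ w m, commutatorMap x M w m = 0)

include hM in
theorem koszulD_eq_zero_of_commutatorMap (n : ℕ) (κ : W [⋀^Fin n]→ₗ[k] M) :
    koszulD x M n κ = 0 := by
  ext v
  simp [koszulD_apply, hM]

include hM in
theorem koszulCoboundaries_eq_bot (n : ℕ) : koszulCoboundaries x M n = ⊥ := by
  cases n with
  | zero => rfl
  | succ n =>
    rw [eq_bot_iff]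
    rintro _ ⟨κ, rfl⟩
    exact koszulD_eq_zero_of_commutatorMap x hM n κ

/-- Antisymmetrization on Hochschild cohomology, when the elements `x w` act on `M` in the same
way from both sides. -/
def antisymmetrizeClass (n : ℕ) : HochschildCohomology k A M n →ₗ[k] (W [⋀^Fin n]→ₗ[k] M) :=
  Submodule.liftQ _ (antisymmetrize x n ∘ₗ Submodule.subtype _) fun c hc => by
    have h := antisymmetrize_mem_koszulCoboundaries x (n := n) (c := c.1) hc
    rwa [koszulCoboundaries_eq_bot x hM] at h

theorem antisymmetrizeClass_hochschildClass (n : ℕ) (c : hochschildCocycles k A M n) :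
    antisymmetrizeClass x hM n (hochschildClass k A M n c) = antisymmetrize x n c.1 := rfl

theorem hochschildClass_eq_zero {n : ℕ} (c : hochschildCocycles k A M n)
    (hc : c.1 ∈ hochschildCoboundaries k A M n) : hochschildClass k A M n c = 0 :=
  (Submodule.Quotient.mk_eq_zero _).2 hc

end KoszulClass

section PolynomialFunctions

theorem antisymmetrizeClass_bijective.{u, v} {k : Type u} [Field k] {V : Type v}
    [AddCommGroup V] [Module k V] [FiniteDimensional k V] {M : Type (max u v)}
    [AddCommGroup M] [Module k M]
    [Module (PolyFun k V) M] [Module (PolyFun k V)ᵐᵒᵖ M] [IsScalarTower k (PolyFun k V) M]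
    [IsScalarTower k (PolyFun k V)ᵐᵒᵖ M] [SMulCommClass (PolyFun k V) (PolyFun k V)ᵐᵒᵖ M]
    (hM : ∀ w m, commutatorMap (SymmetricAlgebra.ι k (Module.Dual k V)) M w m = 0) (n : ℕ) :
    Function.Bijective (antisymmetrizeClass (SymmetricAlgebra.ι k (Module.Dual k V)) hM n) := by
  have h := antisymmetrizeBijective_symmetricAlgebra (k := k) (W := Module.Dual k V) n M
  constructor
  · refine (injective_iff_map_eq_zero _).2 fun z hz => ?_
    obtain ⟨c, rfl⟩ := Submodule.mkQ_surjective _ z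
    refine hochschildClass_eq_zero c (h.inj c.1 c.2 ?_)
    rw [koszulCoboundaries_eq_bot _ hM]
    exact hz
  · intro κ
    obtain ⟨c, hc, hκ⟩ := h.surj κ (koszulD_eq_zero_of_commutatorMap _ hM n κ)
    rw [koszulCoboundaries_eq_bot _ hM] at hκ
    exact ⟨hochschildClass k _ M n ⟨c, hc⟩, sub_eq_zero.1 hκ⟩

variable {k : Type*} [Field k] {V : Type*} [AddCommGroup V] [Module k V] [FiniteDimensional k V]

/-- The isomorphism `H^n(k[V], k[U]) ≅ Λ^n V ⊗ k[U]` given by antisymmetrization on linear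
functions. -/
noncomputable def restrictedCohomologyEquiv (U : Submodule k V) (n : ℕ) :
    HochschildCohomology k (PolyFun k V) (RestrictedBimodule U) n ≃ₗ[k]
      ⋀[k]^n V ⊗[k] PolyFun k U :=
  LinearEquiv.ofBijective _
      (antisymmetrizeClass_bijective (commutatorMap_restricted U) n) ≪≫ₗ
    (PullbackBimodule.of _ _).symm.alternatingMapCongrRight ≪≫ₗ
    (LinearEquiv.ofBijective _
      (contractAlternating_bijective (PolyFun k U) (Module.finBasis k V) n)).symm

theorem contractWith_restrictedCohomologyEquiv (U : Submodule k V) (n : ℕ)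
    (z : HochschildCohomology k (PolyFun k V) (RestrictedBimodule U) n)
    (y : Fin n → Module.Dual k V) :
    contractWith (PolyFun k U) y (restrictedCohomologyEquiv U n z) =
      (PullbackBimodule.of _ _).symm
        (antisymmetrizeClass _ (commutatorMap_restricted U) n z y) := by
  rw [← contractAlternating_apply]
  exact DFunLike.congr_fun (LinearEquiv.apply_symm_apply (LinearEquiv.ofBijective _
    (contractAlternating_bijective (PolyFun k U) (Module.finBasis k V) n)) _) y

variable {G : Type*} [Group G] {ρ : Representation k G V} {g : G} {a : ℕ}

namespace AdaptedBasis

variable (B : AdaptedBasis ρ g a)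

/-- Division by the moved coordinates, normalized to be left inverse to the commutators with them
in `k[V]g`, and zero for the invariant coordinates. -/
noncomputable def commutatorInverse (j : Fin (a + fixedCodim ρ g)) :
    TwistedBimodule ρ g →ₗ[k] TwistedBimodule ρ g :=
  (PullbackBimodule.of _ _).toLinearMap ∘ₗ
    (Fin.append (fun _ => 0) (fun i => (1 - (B.eigenvalue i)⁻¹)⁻¹) j • coordDiv B.coords j) ∘ₗ
    (PullbackBimodule.of _ _).symm.toLinearMap

omit [FiniteDimensional k V] in
theorem commutatorInverse_of (j : Fin (a + fixedCodim ρ g)) (m : PolyFun k V) :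
    B.commutatorInverse j (PullbackBimodule.of _ _ m) = PullbackBimodule.of _ _
      (Fin.append (fun _ => 0) (fun i => (1 - (B.eigenvalue i)⁻¹)⁻¹) j • coordDiv B.coords j m) :=
  rfl

omit [FiniteDimensional k V] in
theorem one_sub_inv_eigenvalue_ne_zero (i : Fin (fixedCodim ρ g)) :
    1 - (B.eigenvalue i)⁻¹ ≠ 0 := by
  rw [sub_ne_zero, ne_comm, inv_ne_one]
  exact B.eigenvalue_ne_one i

/-- Every Koszul cocycle with values in `k[V]g` is cohomologous to one whose values on coordinates
do not involve the moved coordinates and vanish on tuples omitting one of them. -/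
theorem exists_koszul_homologous {n : ℕ}
    (κ : Module.Dual k V [⋀^Fin n]→ₗ[k] TwistedBimodule ρ g)
    (hκ : koszulD (SymmetricAlgebra.ι k _) _ n κ = 0) :
    ∃ κ' : Module.Dual k V [⋀^Fin n]→ₗ[k] TwistedBimodule ρ g,
      κ - κ' ∈ koszulCoboundaries (SymmetricAlgebra.ι k _) _ n ∧
      ∀ v : Fin n → Fin (a + fixedCodim ρ g), Function.Injective v → ∀ i,
        coordDiv B.coords (Fin.natAdd a i)
          ((PullbackBimodule.of _ _).symm (κ' (B.coords ∘ v))) = 0 ∧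
        (Fin.natAdd a i ∉ Set.range v → κ' (B.coords ∘ v) = 0) := by
  have hcomm (j : Fin (a + fixedCodim ρ g)) : ∃ t : k, ∀ m : PolyFun k V,
      commutatorMap (SymmetricAlgebra.ι k _) (TwistedBimodule ρ g) (B.coords j)
        (PullbackBimodule.of _ _ m) =
      PullbackBimodule.of _ _ (t • (SymmetricAlgebra.ι k _ (B.coords j) * m)) := by
    cases j using Fin.addCases with
    | left i => exact ⟨0, fun m => by rw [commutatorMap_castAdd, zero_smul, map_zero]⟩
    | right i => exact ⟨_, B.commutatorMap_natAdd i⟩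
  have hs (j) (hj : j ∈ Finset.univ.map (Fin.natAddEmb a)) (m) : B.commutatorInverse j
      (commutatorMap (SymmetricAlgebra.ι k _) _ (B.coords j) m) = m := by
    obtain ⟨i, -, rfl⟩ := Finset.mem_map.1 hj
    obtain ⟨m, rfl⟩ := (PullbackBimodule.of _ _).surjective m
    change B.commutatorInverse (Fin.natAdd a i)
      (commutatorMap _ _ (B.coords (Fin.natAdd a i)) _) = _
    rw [commutatorMap_natAdd, commutatorInverse_of, (coordDiv B.coords _).map_smul,
      coordDiv_mul_self, Fin.append_right,
      inv_smul_smul₀ (B.one_sub_inv_eigenvalue_ne_zero i)]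
  have hs' (j l) (hl : l ≠ j) (m) :
      commutatorMap (SymmetricAlgebra.ι k _) _ (B.coords l) (B.commutatorInverse j m) =
        B.commutatorInverse j (commutatorMap (SymmetricAlgebra.ι k _) _ (B.coords l) m) := by
    obtain ⟨m, rfl⟩ := (PullbackBimodule.of _ _).surjective m
    obtain ⟨t, ht⟩ := hcomm l
    rw [commutatorInverse_of, ht, ht, commutatorInverse_of, (coordDiv B.coords _).map_smul,
      coordDiv_mul_of_ne _ hl, mul_smul_comm, smul_comm]
  have hss (i j m) : B.commutatorInverse i (B.commutatorInverse j m) =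
      B.commutatorInverse j (B.commutatorInverse i m) := by
    obtain ⟨m, rfl⟩ := (PullbackBimodule.of _ _).surjective m
    simp only [commutatorInverse_of, map_smul]
    rw [coordDiv_comm, smul_comm]
  obtain ⟨κ', h, h'⟩ := exists_koszul_homologous_of_leftInverse (SymmetricAlgebra.ι k _) B.coords
    (Finset.univ.map (Fin.natAddEmb a)) B.commutatorInverse hs (fun j _ => hs' j) hss κ hκ
  refine ⟨κ', h, fun v hv i => ?_⟩
  obtain ⟨h₁, h₂⟩ := h' v hv (Fin.natAdd a i) (by simp)
  refine ⟨?_, h₂⟩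
  have h₃ := B.commutatorInverse_of (Fin.natAdd a i)
    ((PullbackBimodule.of _ _).symm (κ' (B.coords ∘ v)))
  rw [LinearEquiv.apply_symm_apply, h₁, Fin.append_right] at h₃
  exact (smul_eq_zero.1 ((PullbackBimodule.of _ _).injective
    (h₃.symm.trans (map_zero _).symm))).resolve_left
    (inv_ne_zero (B.one_sub_inv_eigenvalue_ne_zero i))

end AdaptedBasis

end PolynomialFunctions

/-! ### Restriction of the twisted cohomology to the invariant subspace -/

section TwistedCohomology

variable {k : Type*} [Field k] {V : Type*} [AddCommGroup V] [Module k V]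
variable {G : Type*} [Group G] {ρ : Representation k G V} {g : G} {a : ℕ}

theorem twistedRestrict_of (f : PolyFun k V) :
    (twistedRestrict ρ g).toLinearMap (PullbackBimodule.of _ _ f) =
      PullbackBimodule.of _ _ (polyRestrict (fixedSpace ρ g) f) := rfl

theorem antisymmetrizeClass_hochschildMap {n : ℕ}
    (c : hochschildCocycles k (PolyFun k V) (TwistedBimodule ρ g) n) :
    antisymmetrizeClass _ (commutatorMap_restricted (fixedSpace ρ g)) n
        (hochschildMap (twistedRestrict ρ g) n (hochschildClass k _ _ n c)) =
      (twistedRestrict ρ g).toLinearMap.compAlternatingMap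
        (antisymmetrize (SymmetricAlgebra.ι k _) n c.1) :=
  antisymmetrize_map _ (twistedRestrict ρ g) c.1

/-- Restriction to `V^g` takes homologous Koszul cocycles to the same alternating map. -/
theorem twistedRestrict_eq_of_sub_mem {n : ℕ}
    {κ κ' : Module.Dual k V [⋀^Fin n]→ₗ[k] TwistedBimodule ρ g}
    (h : κ - κ' ∈ koszulCoboundaries (SymmetricAlgebra.ι k _) _ n) :
    (twistedRestrict ρ g).toLinearMap.compAlternatingMap κ =
      (twistedRestrict ρ g).toLinearMap.compAlternatingMap κ' := by
  have h' := map_mem_koszulCoboundaries _ (twistedRestrict ρ g) h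
  rw [koszulCoboundaries_eq_bot _ (commutatorMap_restricted _), Submodule.mem_bot] at h'
  ext v
  have h₁ := DFunLike.congr_fun h' v
  rw [LinearMap.compAlternatingMap_apply, AlternatingMap.sub_apply, map_sub] at h₁
  exact sub_eq_zero.1 h₁

variable [FiniteDimensional k V]

namespace AdaptedBasis

variable (B : AdaptedBasis ρ g a)

include B in
theorem hochschildMap_twistedRestrict_injective (n : ℕ) :
    Function.Injective (hochschildMap (twistedRestrict ρ g) n) := by
  refine (injective_iff_map_eq_zero _).2 fun z hz => ?_
  obtain ⟨c, rfl⟩ := Submodule.mkQ_surjective _ z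
  have hκ := antisymmetrize_hochschildD (SymmetricAlgebra.ι k (Module.Dual k V)) c.1
  rw [show hochschildD k _ _ n c.1 = 0 from c.2, map_zero] at hκ
  obtain ⟨κ', h, h'⟩ := B.exists_koszul_homologous _ hκ.symm
  have hr : (twistedRestrict ρ g).toLinearMap.compAlternatingMap κ' = 0 := by
    rw [← twistedRestrict_eq_of_sub_mem h, ← antisymmetrizeClass_hochschildMap]
    exact (congrArg _ hz).trans (map_zero _)
  have hκ' : κ' = 0 := by
    refine B.coords.ext_alternating fun v hv => ?_
    obtain ⟨f, hf⟩ := (PullbackBimodule.of _ _).surjective (κ' (B.coords ∘ v))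
    have h₁ := DFunLike.congr_fun hr (B.coords ∘ v)
    rw [LinearMap.compAlternatingMap_apply, ← hf, twistedRestrict_of] at h₁
    have h₂ : polyRestrict (fixedSpace ρ g) f = 0 :=
      (PullbackBimodule.of _ _).injective (h₁.trans (map_zero _).symm)
    have h₃ := B.extend_polyRestrict f fun i => by
      have := (h' v hv i).1
      rwa [← hf, LinearEquiv.symm_apply_apply] at this
    rw [h₂, map_zero] at h₃
    exact hf.symm.trans (by rw [← h₃, map_zero]; rfl)
  rw [hκ', sub_zero] at h
  exact hochschildClass_eq_zero c
    ((antisymmetrizeBijective_symmetricAlgebra n (TwistedBimodule ρ g)).inj c.1 c.2 h)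

/-- Classes coming from `k[V]g` vanish on coordinates unless all the moved ones occur. -/
theorem antisymmetrizeClass_hochschildMap_eq_zero {n : ℕ}
    (z : HochschildCohomology k (PolyFun k V) (TwistedBimodule ρ g) n)
    (v : Fin n → Fin (a + fixedCodim ρ g)) (hv : Function.Injective v) (i : Fin (fixedCodim ρ g))
    (hi : Fin.natAdd a i ∉ Set.range v) :
    antisymmetrizeClass _ (commutatorMap_restricted (fixedSpace ρ g)) n
      (hochschildMap (twistedRestrict ρ g) n z) (B.coords ∘ v) = 0 := by
  obtain ⟨c, rfl⟩ := Submodule.mkQ_surjective _ z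
  have hκ := antisymmetrize_hochschildD (SymmetricAlgebra.ι k (Module.Dual k V)) c.1
  rw [show hochschildD k _ _ n c.1 = 0 from c.2, map_zero] at hκ
  obtain ⟨κ', h, h'⟩ := B.exists_koszul_homologous _ hκ.symm
  have h₁ := antisymmetrizeClass_hochschildMap c
  rw [twistedRestrict_eq_of_sub_mem h] at h₁
  refine (DFunLike.congr_fun h₁ _).trans ?_
  rw [LinearMap.compAlternatingMap_apply, (h' v hv i).2 hi, map_zero]

/-- Conversely, an alternating map vanishing on such coordinates extends to a Koszul cocycle of
`k[V]g`, constant along the moved directions. -/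
theorem exists_antisymmetrizeClass_hochschildMap_eq {n : ℕ}
    (κ : Module.Dual k V [⋀^Fin n]→ₗ[k] RestrictedBimodule (fixedSpace ρ g))
    (hκ : ∀ v : Fin n → Fin (a + fixedCodim ρ g), Function.Injective v →
      ∀ i, Fin.natAdd a i ∉ Set.range v → κ (B.coords ∘ v) = 0) :
    ∃ z : HochschildCohomology k (PolyFun k V) (TwistedBimodule ρ g) n,
      antisymmetrizeClass _ (commutatorMap_restricted (fixedSpace ρ g)) n
        (hochschildMap (twistedRestrict ρ g) n z) = κ := by
  let E : RestrictedBimodule (fixedSpace ρ g) →ₗ[k] TwistedBimodule ρ g :=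
    (PullbackBimodule.of _ _).toLinearMap ∘ₗ B.extend.toLinearMap ∘ₗ
      (PullbackBimodule.of _ _).symm.toLinearMap
  have hE (m) : (twistedRestrict ρ g).toLinearMap (E m) = m := by
    change PullbackBimodule.of _ _ (polyRestrict _ (B.extend _)) = m
    rw [polyRestrict_extend]
    exact LinearEquiv.apply_symm_apply _ _
  have hD : koszulD (SymmetricAlgebra.ι k (Module.Dual k V)) _ n (E.compAlternatingMap κ) = 0 := by
    refine B.coords.ext_alternating fun v hv => ?_
    rw [koszulD_apply]
    refine Finset.sum_eq_zero fun i _ => ?_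
    have h : commutatorMap (SymmetricAlgebra.ι k (Module.Dual k V)) (TwistedBimodule ρ g)
        (B.coords (v i)) (E (κ (B.coords ∘ i.removeNth v))) = 0 := by
      generalize hj : v i = j
      cases j using Fin.addCases with
      | left m => exact B.commutatorMap_castAdd m _
      | right m =>
        rw [hκ (i.removeNth v) (hv.comp Fin.succAbove_right_injective) m, map_zero, map_zero]
        rintro ⟨l, hl⟩
        exact Fin.succAbove_ne i l (hv (hl.trans hj.symm))
    exact (congrArg _ h).trans (smul_zero _)
  obtain ⟨c, hc, h⟩ :=
    (antisymmetrizeBijective_symmetricAlgebra n (TwistedBimodule ρ g)).surj _ hD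
  refine ⟨hochschildClass k _ _ n ⟨c, hc⟩, ?_⟩
  rw [antisymmetrizeClass_hochschildMap, twistedRestrict_eq_of_sub_mem h]
  ext v
  exact hE _

include B in
theorem subsingleton_hochschildCohomology {n : ℕ} (hn : n < fixedCodim ρ g) :
    Subsingleton (HochschildCohomology k (PolyFun k V) (TwistedBimodule ρ g) n) := by
  have h (z : HochschildCohomology k (PolyFun k V) (TwistedBimodule ρ g) n) : z = 0 := by
    apply B.hochschildMap_twistedRestrict_injective n
    apply (antisymmetrizeClass_bijective (commutatorMap_restricted (fixedSpace ρ g)) n).injective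
    rw [map_zero, map_zero]
    refine B.coords.ext_alternating fun v hv => ?_
    -- the `n` arguments cannot exhaust the moved coordinates
    obtain ⟨i, hi⟩ : ∃ i, Fin.natAdd a i ∉ Set.range v := by
      by_contra! hcon
      choose l hl using hcon
      have hinj : Function.Injective l := fun i j hij => by
        have := (hl i).symm.trans ((congrArg v hij).trans (hl j))
        exact Fin.natAdd_injective _ _ this
      have := Fintype.card_le_of_injective l hinj
      simp at this
      omega
    exact B.antisymmetrizeClass_hochschildMap_eq_zero z v hv i hi
  exact ⟨fun z w => (h z).trans (h w).symm⟩

include B in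
theorem range_restrictedCohomologyEquiv_comp (j : ℕ) :
    LinearMap.range ((restrictedCohomologyEquiv (fixedSpace ρ g) (j + fixedCodim ρ g)).toLinearMap
      ∘ₗ hochschildMap (twistedRestrict ρ g) (j + fixedCodim ρ g)) =
    LinearMap.range (LinearMap.rTensor (PolyFun k (fixedSpace ρ g))
      (wedgeSub (fixedSpace ρ g) (movedSpace ρ g) j (fixedCodim ρ g))) := by
  apply le_antisymm
  · rintro _ ⟨z, rfl⟩
    refine mem_range_rTensor_wedgeSub B.basis B.fixedBasis B.movedBasis B.basis_castAdd
      B.basis_natAdd _ _ fun v hv i hi => ?_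
    simp only [← coords_apply]
    rw [LinearMap.comp_apply, LinearEquiv.coe_coe, contractWith_restrictedCohomologyEquiv]
    exact (congrArg _ (B.antisymmetrizeClass_hochschildMap_eq_zero z v hv i hi)).trans (map_zero _)
  · rintro _ ⟨t, rfl⟩
    set T := LinearMap.rTensor (PolyFun k (fixedSpace ρ g))
      (wedgeSub (fixedSpace ρ g) (movedSpace ρ g) j (fixedCodim ρ g)) t with hT
    let w := (restrictedCohomologyEquiv (fixedSpace ρ g) (j + fixedCodim ρ g)).symm T
    obtain ⟨z, hz⟩ := B.exists_antisymmetrizeClass_hochschildMap_eq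
      (antisymmetrizeClass _ (commutatorMap_restricted (fixedSpace ρ g)) _ w) fun v hv i hi => by
        have h := contractWith_rTensor_wedgeSub_eq_zero B.basis B.fixedBasis B.movedBasis
          B.basis_castAdd B.basis_natAdd (PolyFun k (fixedSpace ρ g)) t v i hi
        have h₁ := contractWith_restrictedCohomologyEquiv _ _ w (B.coords ∘ v)
        rw [LinearEquiv.apply_symm_apply] at h₁
        simp only [← coords_apply] at h
        exact (PullbackBimodule.of _ _).symm.injective
          (h₁.symm.trans (h.trans (map_zero _).symm))
    refine ⟨z, ?_⟩
    rw [LinearMap.comp_apply, LinearEquiv.coe_coe,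
      (antisymmetrizeClass_bijective (commutatorMap_restricted (fixedSpace ρ g)) _).injective hz]
    exact LinearEquiv.apply_symm_apply _ _

/-- The isomorphism `H^{j+d}(k[V], k[V]g) ≅ Λ^j V^g ⊗ Λ^d (V^g)^∨ ⊗ k[V^g]`: both sides are
subspaces of `Λ^{j+d} V ⊗ k[V^g]`, with the same image. -/
noncomputable def twistedCohomologyEquiv (j : ℕ) :
    HochschildCohomology k (PolyFun k V) (TwistedBimodule ρ g) (j + fixedCodim ρ g) ≃ₗ[k]
      (⋀[k]^j (fixedSpace ρ g) ⊗[k] ⋀[k]^(fixedCodim ρ g) (movedSpace ρ g)) ⊗[k]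
        PolyFun k (fixedSpace ρ g) :=
  LinearEquiv.ofInjective
      ((restrictedCohomologyEquiv (fixedSpace ρ g) (j + fixedCodim ρ g)).toLinearMap ∘ₗ
        hochschildMap (twistedRestrict ρ g) (j + fixedCodim ρ g))
      ((restrictedCohomologyEquiv (fixedSpace ρ g) (j + fixedCodim ρ g)).injective.comp
        (B.hochschildMap_twistedRestrict_injective _)) ≪≫ₗ
    LinearEquiv.ofEq _ _ (B.range_restrictedCohomologyEquiv_comp j) ≪≫ₗ
    (LinearEquiv.ofInjective _ (Module.Flat.rTensor_preserves_injective_linearMap _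
      (wedgeSub_injective B.basis B.fixedBasis B.movedBasis B.basis_castAdd
        B.basis_natAdd _ _))).symm

theorem rTensor_wedgeSub_twistedCohomologyEquiv (j : ℕ)
    (z : HochschildCohomology k (PolyFun k V) (TwistedBimodule ρ g) (j + fixedCodim ρ g)) :
    LinearMap.rTensor (PolyFun k (fixedSpace ρ g))
        (wedgeSub (fixedSpace ρ g) (movedSpace ρ g) j (fixedCodim ρ g))
        (B.twistedCohomologyEquiv j z) =
      restrictedCohomologyEquiv (fixedSpace ρ g) (j + fixedCodim ρ g)
        (hochschildMap (twistedRestrict ρ g) (j + fixedCodim ρ g) z) :=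
  congrArg Subtype.val (LinearEquiv.apply_symm_apply (LinearEquiv.ofInjective _
    (Module.Flat.rTensor_preserves_injective_linearMap (M := PolyFun k (fixedSpace ρ g)) _
      (wedgeSub_injective B.basis B.fixedBasis B.movedBasis B.basis_castAdd
        B.basis_natAdd j (fixedCodim ρ g)))) _)

end AdaptedBasis

end TwistedCohomology

theorem natCast_ne_zero_of_lt_ringChar {k : Type*} [Ring k] [NoZeroDivisors k] [Nontrivial k]
    {n : ℕ} (hn : n ≠ 0) (h : ringChar k = 0 ∨ n < ringChar k) : (n : k) ≠ 0 := by
  rw [Ne, ringChar.spec]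
  intro hdvd
  rcases h with h | h
  · rw [h, zero_dvd_iff] at hdvd
    exact hn hdvd
  · exact (Nat.le_of_dvd (Nat.pos_of_ne_zero hn) hdvd).not_gt h

theorem mainTheorem6 {k : Type*} [Field k] [IsAlgClosed k]
    {V : Type*} [AddCommGroup V] [Module k V] [FiniteDimensional k V]
    {G : Type*} [Group G] [Finite G] (ρ : Representation k G V)
    (hchar : ringChar k = 0 ∨ (Module.finrank k V < ringChar k ∧ Nat.card G < ringChar k))
    (g : G) :
    (∀ i < fixedCodim ρ g,
      Subsingleton (HochschildCohomology k (PolyFun k V) (TwistedBimodule ρ g) i)) ∧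
    ∃ (Φ : ∀ j : ℕ,
        HochschildCohomology k (PolyFun k V) (TwistedBimodule ρ g) (j + fixedCodim ρ g) ≃ₗ[k]
          (⋀[k]^j (fixedSpace ρ g) ⊗[k] ⋀[k]^(fixedCodim ρ g) (movedSpace ρ g)) ⊗[k]
            PolyFun k (fixedSpace ρ g))
      (Ψ : ∀ i : ℕ,
        HochschildCohomology k (PolyFun k V) (RestrictedBimodule (fixedSpace ρ g)) i ≃ₗ[k]
          ⋀[k]^i V ⊗[k] PolyFun k (fixedSpace ρ g)),
      (∀ (i : ℕ)
        (c : hochschildCocycles k (PolyFun k V) (RestrictedBimodule (fixedSpace ρ g)) i)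
        (y : Fin i → Module.Dual k V),
        contractWith (PolyFun k (fixedSpace ρ g)) y (Ψ i (hochschildClass k _ _ i c)) =
          ∑ σ : Equiv.Perm (Fin i), ((Equiv.Perm.sign σ : ℤˣ) : ℤ) •
            (PullbackBimodule.of _ _).symm
              (c.1 fun j => SymmetricAlgebra.ι k (Module.Dual k V) (y (σ j)))) ∧
      ∀ (j : ℕ)
        (x : HochschildCohomology k (PolyFun k V) (TwistedBimodule ρ g) (j + fixedCodim ρ g)),
        Ψ (j + fixedCodim ρ g) (hochschildMap (twistedRestrict ρ g) (j + fixedCodim ρ g) x) =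
          LinearMap.rTensor (PolyFun k (fixedSpace ρ g))
            (wedgeSub (fixedSpace ρ g) (movedSpace ρ g) j (fixedCodim ρ g)) (Φ j x) := by
  obtain ⟨a, ⟨B⟩⟩ := exists_adaptedBasis ρ g (iSup_eigenspace_representation ρ
    (natCast_ne_zero_of_lt_ringChar Nat.card_pos.ne' (hchar.imp_right And.right)) g)
  refine ⟨fun i hi => B.subsingleton_hochschildCohomology hi, B.twistedCohomologyEquiv,
    restrictedCohomologyEquiv (fixedSpace ρ g), fun i c y => ?_,
    fun j z => (B.rTensor_wedgeSub_twistedCohomologyEquiv j z).symm⟩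
  rw [contractWith_restrictedCohomologyEquiv, antisymmetrizeClass_hochschildClass,
    antisymmetrize_apply, map_sum]
  refine Finset.sum_congr rfl fun σ _ => ?_
  rw [Units.smul_def, map_zsmul]
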